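/- Let $K$ be an algebraically closed field of characteristic $0$, let $C \subset \mathbb{P}^2$ be an irreducible plane curve over $K$ of degree $d \ge 4$ with function field $K(C)$, let $\hat{C} \to C$ be its normalization, let $r : \hat{C} \to \mathbb{P}^2$ be the induced morphism, and assume that the genus $g$ of $\hat{C}$ satisfies $g \ge 1$. For a point $P \in \mathbb{P}^2$ let $\pi_P : C \dashrightarrow \mathbb{P}^1$ be the projection from $P$. A smooth point $P$ of $C$ (respectively, a point $P \in \mathbb{P}^2 \setminus C$) is called an inner (respectively, outer) Galois point for $C$ if the field extension $K(C)/\pi_P^* K(\mathbb{P}^1)$ is Galois. Let $\delta(C)$ and $\delta'(C)$ be the numbers of inner and of outer Galois points for $C$. If $r$ is not unramified, that is, if there is a point $\hat{Q} \in \hat{C}$ at which the differential of $r$ is zero, then $$\delta(C) + \delta'(C) \le 2.$$ -/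

import Mathlib

/-- An irreducible plane curve of degree `d` in the projective plane over `K`, given by an
irreducible homogeneous polynomial of degree `d` in three variables. -/
structure PlaneCurve (K : Type*) [Field K] (d : ℕ) where
  /-- a defining polynomial -/
  poly : MvPolynomial (Fin 3) K
  irreducible : Irreducible poly
  homogeneous : poly.IsHomogeneous d

/-- A point of the smooth projective model of a function field `L` in one variable over `K`:
a discrete valuation ring with field of fractions `L` that contains `K`. -/
structure Place (K L : Type*) [Field K] [Field L] [Algebra K L] where
  /-- the valuation ring, that is, the local ring of the smooth model at the point -/
  ring : ValuationSubring L
  algebraMap_mem : ∀ c : K, algebraMap K L c ∈ ring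
  isDVR : IsDiscreteValuationRing ring

/-- The differentials of `L` over `K` that are regular at the place `v` with valuation ring `R`:
the image of the Kähler differentials of `R` over `K` in those of `L` over `K`. -/
noncomputable def Place.regularAt {K L : Type*} [Field K] [Field L] [Algebra K L]
    (v : Place K L) : Submodule K (Ω[L⁄K]) :=
  Submodule.span K {ω | ∃ f ∈ v.ring, ∃ g ∈ v.ring, ω = f • KaehlerDifferential.D K L g}

/-- The genus of the smooth projective model of `L`: the dimension over `K` of the space of
everywhere regular differentials. -/
noncomputable def functionFieldGenus (K L : Type*) [Field K] [Field L] [Algebra K L] : ℕ :=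
  Module.finrank K (⨅ v : Place K L, v.regularAt : Submodule K (Ω[L⁄K]))

namespace PlaneCurve

variable {K : Type*} [Field K] {d : ℕ} (C : PlaneCurve K d)

/-- The homogeneous coordinate ring of the curve. -/
abbrev CoordRing : Type _ := MvPolynomial (Fin 3) K ⧸ Ideal.span {C.poly}

instance isPrime_span : (Ideal.span {C.poly}).IsPrime :=
  (Ideal.span_singleton_prime C.irreducible.ne_zero).2 C.irreducible.prime

/-- The field of fractions of the homogeneous coordinate ring. -/
abbrev Frac : Type _ := FractionRing C.CoordRing

/-- A form, seen in the field of fractions of the homogeneous coordinate ring. -/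
noncomputable def toFrac : MvPolynomial (Fin 3) K →ₐ[K] C.Frac :=
  (IsScalarTower.toAlgHom K C.CoordRing C.Frac).comp (Ideal.Quotient.mkₐ K (Ideal.span {C.poly}))

/-- The function field `K(C)`: quotients `a / b` of forms of the same degree, where `b` does not
vanish identically on the curve. -/
noncomputable def functionField : IntermediateField K C.Frac where
  carrier := {f | ∃ (n : ℕ) (a b : MvPolynomial (Fin 3) K), a.IsHomogeneous n ∧
    b.IsHomogeneous n ∧ C.toFrac b ≠ 0 ∧ f = C.toFrac a / C.toFrac b}
  mul_mem' := by
    rintro _ _ ⟨n, a, b, ha, hb, h, rfl⟩ ⟨m, a', b', ha', hb', h', rfl⟩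
    refine ⟨n + m, a * a', b * b', ha.mul ha', hb.mul hb', ?_, ?_⟩
    · rw [map_mul]; exact mul_ne_zero h h'
    · rw [map_mul, map_mul, div_mul_div_comm]
  add_mem' := by
    rintro _ _ ⟨n, a, b, ha, hb, h, rfl⟩ ⟨m, a', b', ha', hb', h', rfl⟩
    refine ⟨n + m, a * b' + b * a', b * b', (ha.mul hb').add (hb.mul ha'), hb.mul hb', ?_, ?_⟩
    · rw [map_mul]; exact mul_ne_zero h h'
    · rw [map_add, map_mul, map_mul, map_mul, div_add_div _ _ h h']
  algebraMap_mem' c := by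
    refine ⟨0, MvPolynomial.C c, 1, MvPolynomial.isHomogeneous_C _ _,
      MvPolynomial.isHomogeneous_one _ _, ?_, ?_⟩
    · rw [map_one]; exact one_ne_zero
    · rw [map_one, div_one, ← MvPolynomial.algebraMap_eq, AlgHom.commutes]
  inv_mem' := by
    rintro _ ⟨n, a, b, ha, hb, h, rfl⟩
    by_cases h0 : C.toFrac a = 0
    · exact ⟨n, a, b, ha, hb, h, by simp [h0]⟩
    · exact ⟨n, b, a, hb, ha, h0, by rw [inv_div]⟩

/-- The genus of the normalization of the curve. -/
noncomputable def genus : ℕ := functionFieldGenus K C.functionField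

/-- The point `P` of the projective plane lies on the curve. -/
def HasPoint (P : Projectivization K (Fin 3 → K)) : Prop := MvPolynomial.eval P.rep C.poly = 0

/-- The point `P` is a smooth point of the curve. -/
def IsSmoothPoint (P : Projectivization K (Fin 3 → K)) : Prop :=
  C.HasPoint P ∧ ∃ i, MvPolynomial.eval P.rep (MvPolynomial.pderiv i C.poly) ≠ 0

/-- The subfield of `K(C)` pulled back from the function field of the projective line by the
projection from `P`: it is generated by the quotients of linear forms that vanish at `P`. -/
noncomputable def projectionField (P : Projectivization K (Fin 3 → K)) :
    IntermediateField K C.functionField :=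
  IntermediateField.adjoin K {f | ∃ a b : MvPolynomial (Fin 3) K,
    a.IsHomogeneous 1 ∧ b.IsHomogeneous 1 ∧
    MvPolynomial.eval P.rep a = 0 ∧ MvPolynomial.eval P.rep b = 0 ∧
    C.toFrac b ≠ 0 ∧ (f : C.Frac) = C.toFrac a / C.toFrac b}

/-- The extension of function fields induced by the projection from `P` is Galois. -/
def ProjectionIsGalois (P : Projectivization K (Fin 3 → K)) : Prop :=
  IsGalois (C.projectionField P) C.functionField

/-- The set of inner Galois points. -/
def innerGaloisPoints : Set (Projectivization K (Fin 3 → K)) :=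
  {P | C.IsSmoothPoint P ∧ C.ProjectionIsGalois P}

/-- The set of outer Galois points. -/
def outerGaloisPoints : Set (Projectivization K (Fin 3 → K)) :=
  {P | ¬ C.HasPoint P ∧ C.ProjectionIsGalois P}

/-- The number `δ(C)` of inner Galois points. -/
noncomputable def delta : ℕ∞ := C.innerGaloisPoints.encard

/-- The number `δ'(C)` of outer Galois points. -/
noncomputable def delta' : ℕ∞ := C.outerGaloisPoints.encard

/-- The point `v` of the normalization is mapped to the point `Q` of the plane: every rational
function `a / b` defined at `Q` is regular at `v`, and it vanishes at `v` exactly if it vanishes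
at `Q` (the local ring at `v` dominates the local ring at `Q`). -/
def MapsTo (v : Place K C.functionField) (Q : Projectivization K (Fin 3 → K)) : Prop :=
  ∀ (n : ℕ) (a b : MvPolynomial (Fin 3) K), a.IsHomogeneous n → b.IsHomogeneous n →
    MvPolynomial.eval Q.rep b ≠ 0 →
    ∃ f : v.ring, ((f : C.functionField) : C.Frac) = C.toFrac a / C.toFrac b ∧
      (f ∈ IsLocalRing.maximalIdeal v.ring ↔ MvPolynomial.eval Q.rep a = 0)

/-- The differential at `v` of the morphism `r` from the normalization to the plane is zero: with
`Q` the image of `v`, every rational function that vanishes at `Q` is pulled back into the square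
of the maximal ideal at `v`, so `r` induces the zero map of cotangent spaces. -/
def DifferentialIsZeroAt (v : Place K C.functionField) : Prop :=
  ∃ Q : Projectivization K (Fin 3 → K), C.MapsTo v Q ∧
    ∀ (n : ℕ) (a b : MvPolynomial (Fin 3) K), a.IsHomogeneous n → b.IsHomogeneous n →
      MvPolynomial.eval Q.rep b ≠ 0 → MvPolynomial.eval Q.rep a = 0 →
      ∃ f : v.ring, ((f : C.functionField) : C.Frac) = C.toFrac a / C.toFrac b ∧
        f ∈ IsLocalRing.maximalIdeal v.ring ^ 2

end PlaneCurve

/-! Let `v` be a place where the differential of `r` vanishes and `Q` its image. Every line through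
`Q` meets the branch at `v` to order at least 2. This forces `Q` to be a singular point of the
curve, so no Galois point, inner or outer, equals `Q`. For a Galois point `P ≠ Q`, the order `e_P`
at `v` of the equation of the line `PQ` is the ramification index of the projection from `P` at `v`,
and `e_P ≥ 2`.

The main claim is that distinct Galois points have distinct `e_P` (`ord_linQuot_ne`). The
decomposition group of `v` for the projection from `P` acts on the cotangent line at `v`. In
positive genus this character is faithful (`eq_one_of_genus_pos`), so by counting its values are all
`n`-th roots of unity, `n` being the order of the group. Since `e_P` divides `n`
(`ord_dvd_card_decompositionGroup`), every `e_P`-th root of unity occurs. If `e_P = e_P'`, a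
primitive root `ζ` of that order occurs for both projections, and by faithfulness through the same
automorphism. It fixes both projection fields, which generate the function field
(`projectionField_sup`), so it is the identity and `ζ = 1`, against `e_P ≥ 2`.

Three Galois points would thus give three linear forms through `Q` with pairwise distinct orders at
`v`, hence linearly independent (`linearIndependent_of_ord_injective`). But the linear forms through
`Q` span a plane.

Faithfulness is proved by comparing expansions. A regular differential `f dt` of maximal order `k`
at `v` is an eigenvector of the pullback by `ρ`. If `ρ t = t (1 + ε)` with `ε` of order at least `j
- 1`, the pullback divided by `f dt` is `1 + (k + j) ε` modulo `t ^ j`. It must equal 1, so in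
characteristic 0 the order of `ε` is at least `j`, and so on for all `j`. -/

namespace Place

/-! ### Orders of vanishing at a place -/

variable {K L : Type*} [Field K] [Field L] [Algebra K L] (v : Place K L)

theorem exists_uniformizer : ∃ t : v.ring, Irreducible t :=
  have := v.isDVR
  IsDiscreteValuationRing.exists_irreducible v.ring

/-- A uniformizer, as an element of the field. -/
noncomputable def unif : L := (v.exists_uniformizer.choose : v.ring)

theorem unif_mem : v.unif ∈ v.ring := v.exists_uniformizer.choose.2

theorem irreducible_unif : Irreducible (⟨v.unif, v.unif_mem⟩ : v.ring) :=
  v.exists_uniformizer.choose_spec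

theorem unif_ne_zero : v.unif ≠ 0 := fun h =>
  v.irreducible_unif.ne_zero (Subtype.ext h)

theorem unif_inv_notMem : v.unif⁻¹ ∉ v.ring := fun h =>
  v.irreducible_unif.not_isUnit
    (IsUnit.of_mul_eq_one ⟨v.unif⁻¹, h⟩ (Subtype.ext (mul_inv_cancel₀ v.unif_ne_zero)))

theorem zpow_unif_mem_iff (n : ℤ) : v.unif ^ n ∈ v.ring ↔ 0 ≤ n := by
  constructor
  · intro h
    by_contra! hn
    obtain ⟨k, rfl⟩ : ∃ k : ℕ, n = -(k + 1 : ℕ) := ⟨(-n - 1).toNat, by omega⟩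
    apply v.unif_inv_notMem
    have h2 := v.ring.mul_mem _ _ h (pow_mem v.unif_mem k)
    rwa [zpow_neg, zpow_natCast, pow_succ, mul_inv, mul_comm (_⁻¹), mul_assoc,
      inv_mul_cancel₀ (pow_ne_zero _ v.unif_ne_zero), mul_one] at h2
  · intro h
    lift n to ℕ using h
    rw [zpow_natCast]
    exact pow_mem v.unif_mem n

theorem exists_eq_zpow {f : L} (hf : f ≠ 0) :
    ∃ n : ℤ, f * v.unif ^ (-n) ∈ v.ring ∧ (f * v.unif ^ (-n))⁻¹ ∈ v.ring := by
  have := v.isDVR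
  obtain ⟨n, u, h⟩ :=
    IsDiscreteValuationRing.exists_units_eq_smul_zpow_of_irreducible v.irreducible_unif hf
  have h2 : f * v.unif ^ (-n) = ((u : v.ring) : L) := by
    have h3 : f = ((u : v.ring) : L) * v.unif ^ n := h
    rw [h3, mul_assoc, ← zpow_add₀ v.unif_ne_zero]; simp
  refine ⟨n, h2 ▸ (u : v.ring).2, ?_⟩
  have h4 : (((u⁻¹ : v.ringˣ) : v.ring) : L) = ((u : v.ring) : L)⁻¹ := by
    apply eq_inv_of_mul_eq_one_left
    have : ((u⁻¹ : v.ringˣ) : v.ring) * (u : v.ring) = 1 := by simp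
    exact congrArg Subtype.val this
  rw [h2, ← h4]
  exact ((u⁻¹ : v.ringˣ) : v.ring).2

open Classical in
/-- The order of vanishing at the place; zero for the zero function. -/
noncomputable def ord (f : L) : ℤ :=
  if hf : f ≠ 0 then (v.exists_eq_zpow hf).choose else 0

theorem ord_spec {f : L} (hf : f ≠ 0) :
    f * v.unif ^ (-v.ord f) ∈ v.ring ∧ (f * v.unif ^ (-v.ord f))⁻¹ ∈ v.ring := by
  rw [ord, dif_pos hf]
  exact (v.exists_eq_zpow hf).choose_spec

/-- The functions that vanish to order at least `n` at the place. -/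
def fil (n : ℤ) : Submodule K L where
  carrier := {f | f * v.unif ^ (-n) ∈ v.ring}
  add_mem' := by
    intro a b ha hb
    simp only [Set.mem_ofPred_eq, add_mul] at *
    exact v.ring.add_mem _ _ ha hb
  zero_mem' := by simp [v.ring.zero_mem]
  smul_mem' := by
    intro c f hf
    simp only [Set.mem_ofPred_eq, Algebra.smul_def, mul_assoc] at *
    exact v.ring.mul_mem _ _ (v.algebraMap_mem c) hf

theorem mem_fil_def {n : ℤ} {f : L} : f ∈ v.fil n ↔ f * v.unif ^ (-n) ∈ v.ring := Iff.rfl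

theorem mem_fil_zero {f : L} : f ∈ v.fil 0 ↔ f ∈ v.ring := by simp [mem_fil_def]

theorem mem_fil {n : ℤ} {f : L} (hf : f ≠ 0) : f ∈ v.fil n ↔ n ≤ v.ord f := by
  obtain ⟨h1, h2⟩ := v.ord_spec hf
  have ht := v.unif_ne_zero
  have key : f * v.unif ^ (-n) = (f * v.unif ^ (-v.ord f)) * v.unif ^ (v.ord f - n) := by
    rw [mul_assoc, ← zpow_add₀ ht]; congr 2; ring
  rw [mem_fil_def, ← sub_nonneg, ← v.zpow_unif_mem_iff, key]
  constructor
  · intro h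
    have := v.ring.mul_mem _ _ h2 h
    rwa [← mul_assoc, inv_mul_cancel₀, one_mul] at this
    exact mul_ne_zero hf (zpow_ne_zero _ ht)
  · exact v.ring.mul_mem _ _ h1

theorem fil_anti {m n : ℤ} (h : m ≤ n) : v.fil n ≤ v.fil m := by
  intro f hf
  by_cases h0 : f = 0
  · rw [h0]; exact zero_mem _
  · rw [v.mem_fil h0] at *; omega

theorem mul_mem_fil {m n : ℤ} {f g : L} (hf : f ∈ v.fil m) (hg : g ∈ v.fil n) :
    f * g ∈ v.fil (m + n) := by
  rw [mem_fil_def] at *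
  have := v.ring.mul_mem _ _ hf hg
  rwa [mul_mul_mul_comm, ← zpow_add₀ v.unif_ne_zero, ← neg_add] at this

theorem mul_mem_fil_of_eq {m n k : ℤ} {f g : L} (hf : f ∈ v.fil m) (hg : g ∈ v.fil n)
    (h : k ≤ m + n) : f * g ∈ v.fil k := v.fil_anti h (v.mul_mem_fil hf hg)

theorem ord_eq_iff {f : L} (hf : f ≠ 0) {n : ℤ} :
    v.ord f = n ↔ f ∈ v.fil n ∧ f ∉ v.fil (n + 1) := by
  rw [v.mem_fil hf, v.mem_fil hf]; omega

theorem mem_fil_ord (f : L) : f ∈ v.fil (v.ord f) := by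
  by_cases h0 : f = 0
  · rw [h0]; exact zero_mem _
  · exact (v.mem_fil h0).2 le_rfl

theorem zpow_unif_mem_fil_iff (n m : ℤ) : v.unif ^ n ∈ v.fil m ↔ m ≤ n := by
  rw [mem_fil_def, ← zpow_add₀ v.unif_ne_zero, zpow_unif_mem_iff]; omega

theorem ord_zpow_unif (n : ℤ) : v.ord (v.unif ^ n) = n := by
  rw [v.ord_eq_iff (zpow_ne_zero _ v.unif_ne_zero), zpow_unif_mem_fil_iff, zpow_unif_mem_fil_iff]
  omega

theorem ord_unif : v.ord v.unif = 1 := by simpa using v.ord_zpow_unif 1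

theorem ord_one : v.ord (1 : L) = 0 := by simpa using v.ord_zpow_unif 0

theorem inv_mem_fil {f : L} (hf : f ≠ 0) : f⁻¹ ∈ v.fil (-v.ord f) := by
  have h := (v.ord_spec hf).2
  rw [mem_fil_def]
  rwa [mul_inv, ← zpow_neg] at h

theorem ord_mul {f g : L} (hf : f ≠ 0) (hg : g ≠ 0) : v.ord (f * g) = v.ord f + v.ord g := by
  apply le_antisymm
  · have h1 := v.mul_mem_fil (v.inv_mem_fil hf) (v.mem_fil_ord (f * g))
    rw [← mul_assoc, inv_mul_cancel₀ hf, one_mul, v.mem_fil hg] at h1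
    omega
  · exact (v.mem_fil (mul_ne_zero hf hg)).1 (v.mul_mem_fil (v.mem_fil_ord f) (v.mem_fil_ord g))

theorem ord_inv {f : L} (hf : f ≠ 0) : v.ord f⁻¹ = -v.ord f := by
  have h := v.ord_mul hf (inv_ne_zero hf)
  rw [mul_inv_cancel₀ hf, ord_one] at h
  omega

theorem ord_div {f g : L} (hf : f ≠ 0) (hg : g ≠ 0) : v.ord (f / g) = v.ord f - v.ord g := by
  rw [div_eq_mul_inv, v.ord_mul hf (inv_ne_zero hg), v.ord_inv hg]; rfl

theorem ord_pow {f : L} (hf : f ≠ 0) (n : ℕ) : v.ord (f ^ n) = n * v.ord f := by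
  induction n with
  | zero => simp [ord_one]
  | succ n ih => rw [pow_succ, v.ord_mul (pow_ne_zero _ hf) hf, ih]; push_cast; ring

theorem ord_prod {ι : Type*} (s : Finset ι) (f : ι → L) (hf : ∀ i ∈ s, f i ≠ 0) :
    v.ord (∏ i ∈ s, f i) = ∑ i ∈ s, v.ord (f i) := by
  classical
  induction s using Finset.induction_on with
  | empty => simp [ord_one]
  | insert a s ha ih =>
    rw [Finset.prod_insert ha, Finset.sum_insert ha, v.ord_mul (hf _ (by simp)), ih]
    · exact fun i hi => hf i (by simp [hi])
    · exact Finset.prod_ne_zero_iff.2 fun i hi => hf i (by simp [hi])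

theorem mem_ring_iff {f : L} (hf : f ≠ 0) : f ∈ v.ring ↔ 0 ≤ v.ord f := by
  rw [← mem_fil_zero, v.mem_fil hf]

theorem algebraMap_mem_fil (c : K) : algebraMap K L c ∈ v.fil 0 :=
  v.mem_fil_zero.2 (v.algebraMap_mem c)

theorem one_mem_fil : (1 : L) ∈ v.fil 0 := by simpa using v.algebraMap_mem_fil 1

theorem ord_algebraMap (c : K) : v.ord (algebraMap K L c) = 0 := by
  by_cases hc : c = 0
  -- The default value of `ord` at zero makes the case `c = 0` true.
  · simp [hc, ord]
  have h0 : algebraMap K L c ≠ 0 := by simpa using hc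
  have h1 := (v.mem_fil h0).1 (v.algebraMap_mem_fil c)
  have h2 := v.algebraMap_mem_fil c⁻¹
  rw [map_inv₀, v.mem_fil (inv_ne_zero h0), v.ord_inv h0] at h2
  omega

theorem eq_zero_of_algebraMap_mem_fil {c : K} {n : ℤ} (hn : 0 < n)
    (h : algebraMap K L c ∈ v.fil n) : c = 0 := by
  by_contra hc
  rw [v.mem_fil (by simpa using hc), ord_algebraMap] at h
  omega

theorem eq_zero_of_forall_mem_fil {f : L} (h : ∀ n, f ∈ v.fil n) : f = 0 := by
  by_contra h0
  have := (v.mem_fil h0).1 (h (v.ord f + 1))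
  omega

theorem pow_mem_fil {f : L} {m : ℤ} (hf : f ∈ v.fil m) (n : ℕ) : f ^ n ∈ v.fil (n * m) := by
  induction n with
  | zero => simpa using v.one_mem_fil
  | succ n ih =>
    rw [pow_succ]
    exact v.mul_mem_fil_of_eq ih hf (by push_cast; ring_nf; rfl)

theorem ne_zero_of_sub_mem {f g : L} (hf : f ≠ 0) (h : g - f ∈ v.fil (v.ord f + 1)) : g ≠ 0 := by
  rintro rfl
  rw [zero_sub, neg_mem_iff, v.mem_fil hf] at h
  omega

theorem ord_eq_of_sub_mem {f g : L} (hf : f ≠ 0) (h : g - f ∈ v.fil (v.ord f + 1)) :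
    v.ord g = v.ord f := by
  rw [v.ord_eq_iff (v.ne_zero_of_sub_mem hf h)]
  refine ⟨?_, fun h2 => ?_⟩
  · have := add_mem (v.fil_anti (by omega) h) (v.mem_fil_ord f)
    rwa [sub_add_cancel] at this
  · have := sub_mem h2 h
    rw [sub_sub_cancel, v.mem_fil hf] at this
    omega

theorem ord_eq_zero_of_sub_algebraMap_mem {f : L} {c : K} (hc : c ≠ 0)
    (h : f - algebraMap K L c ∈ v.fil 1) : f ≠ 0 ∧ v.ord f = 0 := by
  have h0 : algebraMap K L c ≠ 0 := by simpa using hc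
  have h1 : f - algebraMap K L c ∈ v.fil (v.ord (algebraMap K L c) + 1) := by
    rwa [ord_algebraMap]
  exact ⟨v.ne_zero_of_sub_mem h0 h1, by rw [v.ord_eq_of_sub_mem h0 h1, ord_algebraMap]⟩

theorem mem_maximalIdeal_pow {f : v.ring} {n : ℕ} :
    f ∈ IsLocalRing.maximalIdeal v.ring ^ n ↔ (f : L) ∈ v.fil n := by
  have := v.isDVR
  rw [v.irreducible_unif.maximalIdeal_eq, Ideal.span_singleton_pow, Ideal.mem_span_singleton]
  constructor
  · rintro ⟨g, rfl⟩
    have h1 : v.unif ^ n ∈ v.fil n := by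
      simpa using (v.zpow_unif_mem_fil_iff n n).2 le_rfl
    simpa using v.mul_mem_fil h1 (v.mem_fil_zero.2 g.2)
  · intro h
    rw [mem_fil_def] at h
    refine ⟨⟨_, h⟩, Subtype.ext ?_⟩
    have : v.unif ^ n ≠ 0 := pow_ne_zero _ v.unif_ne_zero
    simp
    field_simp

theorem mem_maximalIdeal {f : v.ring} :
    f ∈ IsLocalRing.maximalIdeal v.ring ↔ (f : L) ∈ v.fil 1 := by
  simpa using v.mem_maximalIdeal_pow (f := f) (n := 1)

/-- The residue field of the place is `K`. -/
def IsRational : Prop := ∀ f ∈ v.ring, ∃ c : K, f - algebraMap K L c ∈ v.fil 1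

variable {v}

theorem IsRational.exists_sub_mem (hv : v.IsRational) {f g : L} (hg : g ≠ 0)
    (hf : f ∈ v.fil (v.ord g)) : ∃ c : K, f - algebraMap K L c * g ∈ v.fil (v.ord g + 1) := by
  have h1 := v.mul_mem_fil hf (v.inv_mem_fil hg)
  rw [add_neg_cancel, mem_fil_zero] at h1
  obtain ⟨c, hc⟩ := hv _ h1
  refine ⟨c, ?_⟩
  have := v.mul_mem_fil hc (v.mem_fil_ord g)
  rwa [sub_mul, mul_assoc, inv_mul_cancel₀ hg, mul_one, add_comm] at this

variable (v)

theorem transcendental_unif [IsAlgClosed K] : Transcendental K v.unif := by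
  intro h
  obtain ⟨c, hc⟩ := minpoly.mem_range_of_degree_eq_one K v.unif
    (IsAlgClosed.degree_eq_one_of_irreducible K (minpoly.irreducible h.isIntegral))
  have h1 := v.ord_unif
  rw [← hc, ord_algebraMap] at h1
  omega

/-- `p` splits, so its value at `f` is a constant times a product of differences `f - c`. -/
theorem ord_aeval_eq_zero [IsAlgClosed K] {f : L}
    (hf : ∀ c : K, f - algebraMap K L c ≠ 0 ∧ v.ord (f - algebraMap K L c) = 0)
    {p : Polynomial K} (hp : p ≠ 0) :
    Polynomial.aeval f p ≠ 0 ∧ v.ord (Polynomial.aeval f p) = 0 := by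
  have h := (IsAlgClosed.splits p).eq_prod_roots
  have key : ∀ s : Multiset K,
      Polynomial.aeval f (s.map fun a => Polynomial.X - Polynomial.C a).prod ≠ 0 ∧
      v.ord (Polynomial.aeval f (s.map fun a => Polynomial.X - Polynomial.C a).prod) = 0 := by
    intro s
    induction s using Multiset.induction_on with
    | empty => simp [ord_one]
    | cons a s ih =>
      rw [Multiset.map_cons, Multiset.prod_cons, map_mul, map_sub, Polynomial.aeval_X,
        Polynomial.aeval_C]
      exact ⟨mul_ne_zero (hf a).1 ih.1, by rw [v.ord_mul (hf a).1 ih.1, (hf a).2, ih.2]; rfl⟩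
  have hc : algebraMap K L p.leadingCoeff ≠ 0 := by simpa using hp
  rw [h, map_mul, Polynomial.aeval_C]
  exact ⟨mul_ne_zero hc (key _).1, by
    rw [v.ord_mul hc (key _).1, ord_algebraMap, (key _).2]; rfl⟩

end Place

/-! ### Transcendence degree one and residue fields -/

/-- The field `L` is algebraic over every subfield `K(x)` with `x` transcendental over `K`. -/
def HasTrdegLEOne (K L : Type*) [Field K] [Field L] [Algebra K L] : Prop :=
  ∀ x : L, Transcendental K x → Algebra.IsAlgebraic (Algebra.adjoin K {x}) L

theorem HasTrdegLEOne.of_isAlgebraic {K L : Type*} [Field K] [Field L] [Algebra K L] (u : L)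
    (h : Algebra.IsAlgebraic (Algebra.adjoin K {u}) L) : HasTrdegLEOne K L := by
  intro x hx
  have h1 : Algebra.trdeg K L ≤ 1 := by
    simpa using Algebra.IsAlgebraic.trdeg_le_cardinalMk K ({u} : Set L)
  have h2 : AlgebraicIndependent K (fun _ : Unit => x) := by
    rwa [algebraicIndependent_unique_type_iff]
  have h3 := h2.isTranscendenceBasis_of_lift_trdeg_le_of_finite (by simpa using h1)
  have h4 := h3.isAlgebraic
  rwa [Set.range_const] at h4

/-- If `f` had no residue in `K`, all nonzero elements of `K[f]` would have order 0 at `v`. In an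
algebraic equation over `K[f]` for the inverse of a uniformizer, the leading term would then have
strictly the lowest order and could not cancel. -/
theorem HasTrdegLEOne.isRational {K L : Type*} [Field K] [IsAlgClosed K] [Field L] [Algebra K L]
    (h : HasTrdegLEOne K L) (v : Place K L) : v.IsRational := by
  intro f hf
  by_contra! hc
  have hc' : ∀ c : K, f - algebraMap K L c ≠ 0 ∧ v.ord (f - algebraMap K L c) = 0 := by
    intro c
    have h0 : f - algebraMap K L c ≠ 0 := fun h0 => hc c (h0 ▸ zero_mem _)
    refine ⟨h0, (v.ord_eq_iff h0).2 ⟨?_, hc c⟩⟩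
    exact sub_mem (v.mem_fil_zero.2 hf) (v.algebraMap_mem_fil c)
  have htr : Transcendental K f := by
    intro ha
    obtain ⟨c, hc⟩ := minpoly.mem_range_of_degree_eq_one K f
      (IsAlgClosed.degree_eq_one_of_irreducible K (minpoly.irreducible ha.isIntegral))
    exact (hc' c).1 (by rw [← hc]; exact sub_self _)
  obtain ⟨P, hP, hP0⟩ := (h f htr).isAlgebraic v.unif⁻¹
  have hA : ∀ a : Algebra.adjoin K {f}, a ≠ 0 → v.ord (a : L) = 0 := by
    rintro ⟨a, ha⟩ ha0
    rw [Algebra.adjoin_singleton_eq_range_aeval] at ha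
    obtain ⟨p, rfl⟩ := ha
    refine (v.ord_aeval_eq_zero hc' ?_).2
    rintro rfl
    exact ha0 (Subtype.ext (map_zero _))
  have hA' : ∀ a : Algebra.adjoin K {f}, (a : L) ∈ v.fil 0 := by
    intro a
    by_cases h0 : a = 0
    · rw [h0]; exact zero_mem _
    · simpa [hA a h0] using v.mem_fil_ord (a : L)
  rw [Polynomial.aeval_eq_sum_range, Finset.sum_range_succ] at hP0
  have h1 : (∑ i ∈ Finset.range P.natDegree, P.coeff i • v.unif⁻¹ ^ i) ∈
      v.fil (1 - P.natDegree) := by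
    refine sum_mem fun i hi => ?_
    refine v.mul_mem_fil_of_eq (hA' _) ?_ (le_of_eq (zero_add _).symm)
    rw [inv_pow, ← zpow_natCast, ← zpow_neg, v.zpow_unif_mem_fil_iff]
    have := Finset.mem_range.1 hi
    omega
  rw [eq_neg_of_add_eq_zero_left hP0, neg_mem_iff] at h1
  have h2 : P.leadingCoeff ≠ 0 := Polynomial.leadingCoeff_ne_zero.2 hP
  have h3 : ((P.leadingCoeff : Algebra.adjoin K {f}) : L) ≠ 0 := fun h => h2 (Subtype.ext h)
  have h4 : v.unif⁻¹ ^ P.natDegree ≠ 0 := pow_ne_zero _ (inv_ne_zero v.unif_ne_zero)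
  change ((P.leadingCoeff : Algebra.adjoin K {f}) : L) * _ ∈ _ at h1
  rw [v.mem_fil (mul_ne_zero h3 h4), v.ord_mul h3 h4, hA _ h2,
    v.ord_pow (inv_ne_zero v.unif_ne_zero), v.ord_inv v.unif_ne_zero, v.ord_unif] at h1
  omega

/-! ### Derivations and differentials at a place -/

section

open Polynomial

/-- Replace an annihilating polynomial by its derivative as long as this still annihilates `g`. The
degree drops, and in characteristic 0 the polynomial never becomes zero. -/
theorem IsAlgebraic.exists_aeval_derivative_ne_zero {A L : Type*} [CommRing A] [IsDomain A]
    [Field L] [CharZero L] [Algebra A L] [FaithfulSMul A L] {g : L} (hg : IsAlgebraic A g) :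
    ∃ F : A[X], aeval g F = 0 ∧ aeval g (derivative F) ≠ 0 := by
  have hinj := FaithfulSMul.algebraMap_injective A L
  have key : ∀ (n : ℕ) (F : A[X]), F.natDegree ≤ n → F ≠ 0 → aeval g F = 0 →
      ∃ F : A[X], aeval g F = 0 ∧ aeval g (derivative F) ≠ 0 := by
    intro n
    induction n with
    | zero =>
      intro F hn hF h0
      rw [eq_C_of_natDegree_le_zero hn, aeval_C] at h0
      have h1 := (map_eq_zero_iff _ hinj).1 h0
      exact absurd (by rw [eq_C_of_natDegree_le_zero hn, h1, C_0]) hF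
    | succ n ih =>
      intro F hn hF h0
      by_cases h1 : aeval g (derivative F) = 0
      · have : CharZero A :=
          ⟨fun m n h => Nat.cast_injective (R := L) (by simpa using congrArg (algebraMap A L) h)⟩
        have hd : F.natDegree ≠ 0 := by
          intro hd
          rw [eq_C_of_natDegree_eq_zero hd, aeval_C] at h0
          have h1 := (map_eq_zero_iff _ hinj).1 h0
          exact absurd (by rw [eq_C_of_natDegree_eq_zero hd, h1, C_0]) hF
        refine ih _ ?_ ?_ h1
        · have := natDegree_derivative_lt hd; omega
        · intro h2
          exact hd (derivative_eq_zero.1 h2)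
      · exact ⟨F, h0, h1⟩
  obtain ⟨F, hF, h0⟩ := hg
  exact key _ F le_rfl hF h0

theorem Derivation.map_aeval_eq_sum {K A L N : Type*} [CommRing K] [CommRing A] [Field L]
    [Algebra K L] [Algebra A L] [AddCommGroup N] [Module K N] [Module L N]
    (D : Derivation K L N) (g : L) (F : A[X]) :
    D (aeval g F) = (∑ i ∈ Finset.range (F.natDegree + 1), g ^ i • D (algebraMap A L (F.coeff i)))
      + aeval g (derivative F) • D g := by
  have h : aeval g F = ∑ i ∈ Finset.range (F.natDegree + 1),
      algebraMap A L (F.coeff i) * g ^ i := by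
    rw [aeval_eq_sum_range]; simp [Algebra.smul_def]
  have h' : aeval g (derivative F) = ∑ i ∈ Finset.range (F.natDegree + 1),
      algebraMap A L (F.coeff i) * (i * g ^ (i - 1)) := by
    conv_lhs => rw [F.as_sum_range_C_mul_X_pow]
    simp [map_sum, derivative_X_pow]
  rw [h, h', map_sum, Finset.sum_smul, ← Finset.sum_add_distrib]
  refine Finset.sum_congr rfl fun i _ => ?_
  rw [D.leibniz, D.leibniz_pow, add_comm, ← Nat.cast_smul_eq_nsmul L, smul_smul, smul_smul,
    mul_assoc]

namespace Place

variable {K L : Type*} [Field K] [Field L] [Algebra K L]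
  (v : Place K L)

theorem ord_aeval {u : L} (hu : 0 < v.ord u) (hu0 : u ≠ 0) {s : K[X]}
    (hs : s ≠ 0) : aeval u s ≠ 0 ∧ v.ord (aeval u s) = s.rootMultiplicity 0 * v.ord u := by
  obtain ⟨q, hq, hq0⟩ := exists_eq_pow_rootMultiplicity_mul_and_not_dvd s hs 0
  have hc : q.eval 0 ≠ 0 := by
    intro h; exact hq0 (dvd_iff_isRoot.2 h)
  have h1 : aeval u q - algebraMap K L (q.eval 0) ∈ v.fil 1 := by
    have h2 : (X : K[X]) ∣ q - C (q.eval 0) := by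
      rw [X_dvd_iff, coeff_sub, coeff_C_zero, coeff_zero_eq_eval_zero, sub_self]
    obtain ⟨r, hr⟩ := h2
    have h3 : aeval u q - algebraMap K L (q.eval 0) = u * aeval u r := by
      rw [← aeval_C u, ← map_sub, hr, map_mul, aeval_X]
    rw [h3]
    refine v.mul_mem_fil_of_eq ((v.mem_fil hu0).2 hu) ?_ (add_zero 1).ge
    rw [aeval_eq_sum_range]
    refine sum_mem fun i _ => Submodule.smul_mem _ _ ?_
    exact v.fil_anti (by positivity) (v.pow_mem_fil (v.mem_fil_ord u) i)
  obtain ⟨h2, h3⟩ := v.ord_eq_zero_of_sub_algebraMap_mem hc h1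
  have h4 : aeval u s = u ^ (s.rootMultiplicity 0) * aeval u q := by
    conv_lhs => rw [hq]
    simp
  rw [h4]
  refine ⟨mul_ne_zero (pow_ne_zero _ hu0) h2, ?_⟩
  rw [v.ord_mul (pow_ne_zero _ hu0) h2, v.ord_pow hu0, h3, add_zero]

variable {v}

/-- Taylor expansion: each further coefficient is a residue, hence in `K`. -/
theorem IsRational.exists_polynomial (hv : v.IsRational) {g : L} (hg : g ∈ v.ring) (n : ℕ) :
    ∃ p : K[X], g - aeval v.unif p ∈ v.fil n := by
  induction n with
  | zero => exact ⟨0, by simpa using v.mem_fil_zero.2 hg⟩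
  | succ n ih =>
    obtain ⟨p, hp⟩ := ih
    have h0 : v.unif ^ n ≠ 0 := pow_ne_zero _ v.unif_ne_zero
    have h1 : v.ord (v.unif ^ n) = n := by rw [v.ord_pow v.unif_ne_zero, v.ord_unif, mul_one]
    obtain ⟨c, hc⟩ := hv.exists_sub_mem h0 (h1.symm ▸ hp)
    refine ⟨p + C c * X ^ n, ?_⟩
    rw [h1] at hc
    simpa [sub_sub] using hc

theorem aeval_unif_mem (p : K[X]) : aeval v.unif p ∈ v.ring := by
  rw [← mem_fil_zero, aeval_eq_sum_range]
  refine sum_mem fun i _ => Submodule.smul_mem _ _ (v.mem_fil_zero.2 (pow_mem v.unif_mem i))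

variable [IsAlgClosed K] [CharZero L]

/-- Approximate `g` to order `N` by a polynomial `q` in the uniformizer, and let `F` be an equation
for `g` over `K[t]` with `F'(g) ≠ 0`. Then `F(q)` is a polynomial in `t` of order at least `N`, so
`δ (F(q))` has order at least `N - 1`. Comparison with `δ (F(g)) = 0` bounds the order of `F'(g) (δ
g - δ q)` below by that of `F'(g)`, so `δ g - δ q` is regular. -/
theorem derivation_mem (hv : v.IsRational) (hL : HasTrdegLEOne K L) (δ : Derivation K L L)
    (hδ : δ v.unif = 1) {g : L} (hg : g ∈ v.ring) : δ g ∈ v.ring := by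
  have hδp : ∀ p : K[X], δ (aeval v.unif p) = aeval v.unif (derivative p) := by
    intro p
    rw [δ.map_aeval, hδ, smul_eq_mul, mul_one]
  have hpoly : ∀ (p : K[X]) (n : ℕ), aeval v.unif p ∈ v.fil n →
      δ (aeval v.unif p) ∈ v.fil (n - 1 : ℤ) := by
    intro p n hp
    by_cases hp0 : p = 0
    · simp [hp0]
    obtain ⟨h1, h2⟩ := v.ord_aeval (by rw [v.ord_unif]; norm_num)
      v.unif_ne_zero hp0
    rw [v.mem_fil h1, h2, v.ord_unif] at hp
    obtain ⟨q, hq, -⟩ := exists_eq_pow_rootMultiplicity_mul_and_not_dvd p hp0 0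
    have h4 : aeval v.unif p = v.unif ^ (p.rootMultiplicity 0) * aeval v.unif q := by
      conv_lhs => rw [hq]
      simp
    rw [h4, δ.leibniz, δ.leibniz_pow, hδ, hδp]
    simp only [smul_eq_mul, mul_one, nsmul_eq_mul]
    refine add_mem ?_ ?_
    · refine v.mul_mem_fil_of_eq (v.pow_mem_fil (v.mem_fil_ord _) _)
        (v.mem_fil_zero.2 (aeval_unif_mem _)) ?_
      rw [v.ord_unif]; omega
    · rcases Nat.eq_zero_or_pos (p.rootMultiplicity 0) with h | h
      · simp [h]
      · have hk : ((p.rootMultiplicity 0 : ℕ) : L) ∈ v.fil 0 := by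
          simpa using v.algebraMap_mem_fil ((p.rootMultiplicity 0 : ℕ) : K)
        refine v.mul_mem_fil_of_eq (v.mem_fil_zero.2 (aeval_unif_mem _))
          (v.mul_mem_fil hk (v.pow_mem_fil (v.mem_fil_ord _) _)) ?_
        rw [v.ord_unif]; push_cast [h]; omega
  have := hL v.unif v.transcendental_unif
  obtain ⟨F, h0, h1⟩ := (this.isAlgebraic g).exists_aeval_derivative_ne_zero
  have hA : ∀ a : Algebra.adjoin K {v.unif}, ∃ p : K[X], (a : L) = aeval v.unif p := by
    rintro ⟨a, ha⟩
    rw [Algebra.adjoin_singleton_eq_range_aeval] at ha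
    obtain ⟨p, rfl⟩ := ha
    exact ⟨p, rfl⟩
  have hAR : ∀ a : Algebra.adjoin K {v.unif}, (a : L) ∈ v.ring := by
    intro a; obtain ⟨p, hp⟩ := hA a; rw [hp]; exact aeval_unif_mem p
  have hpow : ∀ {q : L} {N : ℤ}, q ∈ v.ring → g - q ∈ v.fil N → ∀ i : ℕ,
      g ^ i - q ^ i ∈ v.fil N := by
    intro q N hq hgq i
    rw [← (Commute.all g q).mul_geom_sum₂]
    refine v.mul_mem_fil_of_eq hgq (v.mem_fil_zero.2 ?_) (add_zero N).ge
    exact sum_mem fun j _ => v.ring.mul_mem _ _ (pow_mem hg _) (pow_mem hq _)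
  set b := aeval g (derivative F)
  -- The extra 1 pays for the order that differentiation loses.
  obtain ⟨N, hN⟩ : ∃ N : ℕ, v.ord b + 1 ≤ N := ⟨(v.ord b + 1).toNat, by omega⟩
  obtain ⟨p, hp⟩ := hv.exists_polynomial hg N
  set q := aeval v.unif p with hqdef
  have hq : q ∈ v.ring := aeval_unif_mem p
  have haev : ∀ H : (Algebra.adjoin K {v.unif})[X], aeval g H - aeval q H ∈ v.fil N := by
    intro H
    rw [aeval_eq_sum_range, aeval_eq_sum_range, ← Finset.sum_sub_distrib]
    refine sum_mem fun i _ => ?_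
    rw [← smul_sub, Algebra.smul_def]
    exact v.mul_mem_fil_of_eq (v.mem_fil_zero.2 (hAR _)) (hpow hq hp i) (zero_add _).ge
  have hq1 : ∃ s : K[X], aeval q F = aeval v.unif s := by
    choose c hc using hA
    refine ⟨∑ i ∈ Finset.range (F.natDegree + 1), c (F.coeff i) * p ^ i, ?_⟩
    rw [aeval_eq_sum_range, map_sum]
    refine Finset.sum_congr rfl fun i _ => ?_
    rw [map_mul, map_pow, ← hc, Algebra.smul_def]; rfl
  have h2 : δ (aeval q F) ∈ v.fil (N - 1 : ℤ) := by
    obtain ⟨s, hs⟩ := hq1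
    rw [hs]
    apply hpoly
    rw [← hs, ← neg_mem_iff, ← zero_sub, ← h0]
    exact haev F
  rw [δ.map_aeval_eq_sum] at h2
  have h3 := δ.map_aeval_eq_sum g F
  rw [h0, map_zero] at h3
  have h4 : (∑ i ∈ Finset.range (F.natDegree + 1), g ^ i •
        δ (algebraMap (Algebra.adjoin K {v.unif}) L (F.coeff i))) -
      (∑ i ∈ Finset.range (F.natDegree + 1), q ^ i •
        δ (algebraMap (Algebra.adjoin K {v.unif}) L (F.coeff i))) ∈ v.fil N := by
    rw [← Finset.sum_sub_distrib]
    refine sum_mem fun i _ => ?_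
    rw [← sub_smul]
    refine v.mul_mem_fil_of_eq (hpow hq hp i) (v.mem_fil_zero.2 ?_) (add_zero _).ge
    obtain ⟨s, hs⟩ := hA (F.coeff i)
    change δ ((F.coeff i : Algebra.adjoin K {v.unif}) : L) ∈ _
    rw [hs, hδp]
    exact aeval_unif_mem _
  have hδq : δ q ∈ v.ring := by rw [hqdef, hδp]; exact aeval_unif_mem _
  have h5 : (aeval g (derivative F) - aeval q (derivative F)) * δ q ∈ v.fil N :=
    v.mul_mem_fil_of_eq (haev _) (v.mem_fil_zero.2 hδq) (add_zero _).ge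
  have h6 : b * (δ g - δ q) ∈ v.fil (v.ord b) := by
    have h7 : b * (δ g - δ q) = -((∑ i ∈ Finset.range (F.natDegree + 1), g ^ i •
        δ (algebraMap (Algebra.adjoin K {v.unif}) L (F.coeff i))) -
      (∑ i ∈ Finset.range (F.natDegree + 1), q ^ i •
        δ (algebraMap (Algebra.adjoin K {v.unif}) L (F.coeff i)))) -
      (aeval g (derivative F) - aeval q (derivative F)) * δ q -
      ((∑ i ∈ Finset.range (F.natDegree + 1), q ^ i •
        δ (algebraMap (Algebra.adjoin K {v.unif}) L (F.coeff i))) +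
        aeval q (derivative F) • δ q) := by
      simp only [smul_eq_mul] at h3 ⊢
      linear_combination -h3
    rw [h7]
    exact sub_mem (sub_mem (neg_mem (v.fil_anti (by omega) h4)) (v.fil_anti (by omega) h5))
      (v.fil_anti (by omega) h2)
  have h8 := v.mul_mem_fil (v.inv_mem_fil h1) h6
  rw [← mul_assoc, inv_mul_cancel₀ h1, one_mul, neg_add_cancel, mem_fil_zero] at h8
  have := v.ring.add_mem _ _ h8 hδq
  rwa [sub_add_cancel] at this

variable (v)

/-- Differentiate an equation `F(g) = 0` over `K[t]` with `F'(g) ≠ 0` and solve for `D g`. -/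
theorem exists_D_eq_smul (hL : HasTrdegLEOne K L) (g : L) : ∃ c : L,
    KaehlerDifferential.D K L g = c • KaehlerDifferential.D K L v.unif := by
  have := hL v.unif v.transcendental_unif
  obtain ⟨F, h0, h1⟩ := (this.isAlgebraic g).exists_aeval_derivative_ne_zero
  set D := KaehlerDifferential.D K L
  have h2 := D.map_aeval_eq_sum g F
  rw [h0, map_zero] at h2
  have hA : ∀ a : Algebra.adjoin K {v.unif}, ∃ c : L, D (a : L) = c • D v.unif := by
    rintro ⟨a, ha⟩
    rw [Algebra.adjoin_singleton_eq_range_aeval] at ha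
    obtain ⟨p, rfl⟩ := ha
    exact ⟨_, D.map_aeval p v.unif⟩
  choose c hc using hA
  refine ⟨-((aeval g (derivative F))⁻¹ *
    ∑ i ∈ Finset.range (F.natDegree + 1), g ^ i * c (F.coeff i)), ?_⟩
  have h3 : aeval g (derivative F) • D g =
      -((∑ i ∈ Finset.range (F.natDegree + 1), g ^ i * c (F.coeff i)) • D v.unif) := by
    rw [eq_neg_iff_add_eq_zero, add_comm, h2, Finset.sum_smul]
    congr 1
    refine Finset.sum_congr rfl fun i _ => ?_
    rw [mul_smul, ← hc]; rfl
  rw [neg_smul, mul_smul, ← smul_neg, ← h3, inv_smul_smul₀ h1]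

theorem exists_kaehler_equiv (hL : HasTrdegLEOne K L) [Nontrivial (Ω[L⁄K])] :
    ∃ e : Ω[L⁄K] ≃ₗ[L] L, e (KaehlerDifferential.D K L v.unif) = 1 := by
  set D := KaehlerDifferential.D K L
  have hspan : Submodule.span L {D v.unif} = ⊤ := by
    rw [eq_top_iff, ← KaehlerDifferential.span_range_derivation, Submodule.span_le]
    rintro _ ⟨g, rfl⟩
    obtain ⟨c, hc⟩ := v.exists_D_eq_smul hL g
    rw [SetLike.mem_coe, hc]
    exact Submodule.smul_mem _ _ (Submodule.mem_span_singleton_self _)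
  have h0 : D v.unif ≠ 0 := by
    intro h
    rw [h, Submodule.span_zero_singleton] at hspan
    exact bot_ne_top hspan
  refine ⟨((LinearEquiv.toSpanNonzeroSingleton L _ _ h0).trans
    (LinearEquiv.ofTop _ hspan)).symm, ?_⟩
  rw [LinearEquiv.symm_apply_eq]
  simp

end Place

end

/-! ### Automorphisms that fix a place -/

section

open Polynomial

namespace Place

variable {K L : Type*} [Field K] [Field L] [Algebra K L] (v : Place K L)

theorem ext_ring {v w : Place K L} (h : v.ring = w.ring) : v = w := by
  cases v; cases w; cases h; rfl

/-- The place obtained by pulling back along an automorphism. -/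
def comap (ρ : L ≃ₐ[K] L) : Place K L where
  ring := v.ring.comap (ρ : L →+* L)
  algebraMap_mem c := by
    rw [ValuationSubring.mem_comap]
    simpa using v.algebraMap_mem c
  isDVR := by
    have := v.isDVR
    refine IsDiscreteValuationRing.RingEquivClass.isDiscreteValuationRing (A := v.ring) (E := v.ring ≃+* _)
      ((ρ.toRingEquiv.subringMap (s := (v.ring.comap (ρ : L →+* L)).toSubring)).trans
        (RingEquiv.subringCongr ?_)).symm
    ext x
    simp only [Subring.mem_map]
    constructor
    · rintro ⟨y, hy, rfl⟩; exact hy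
    · intro hx
      refine ⟨ρ.symm x, ?_, by simp⟩
      change ρ (ρ.symm x) ∈ v.ring
      rwa [ρ.apply_symm_apply]

theorem mem_comap {ρ : L ≃ₐ[K] L} {f : L} : f ∈ (v.comap ρ).ring ↔ ρ f ∈ v.ring := Iff.rfl

theorem comap_mul (ρ τ : L ≃ₐ[K] L) : v.comap (ρ * τ) = (v.comap ρ).comap τ := ext_ring rfl

theorem comap_one : v.comap 1 = v := ext_ring rfl

/-- The two orders are proportional; the factor is 1 because `ρ` is surjective, so that some
function pulls back to a uniformizer. -/
theorem ord_comap (ρ : L ≃ₐ[K] L) (f : L) : (v.comap ρ).ord f = v.ord (ρ f) := by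
  have h0 : ∀ g : L, g ≠ 0 → ρ g ≠ 0 := fun g hg => by simpa using hg
  set w := v.comap ρ
  have key : ∀ g : L, g ≠ 0 → v.ord (ρ g) = w.ord g * v.ord (ρ w.unif) := by
    intro g hg
    set u := g * w.unif ^ (-w.ord g)
    have hu0 : u ≠ 0 := mul_ne_zero hg (zpow_ne_zero _ w.unif_ne_zero)
    obtain ⟨h1, h2⟩ := w.ord_spec hg
    have h3 : v.ord (ρ u) = 0 := by
      have h4 := (v.mem_ring_iff (h0 _ hu0)).1 h1
      have h5 := (v.mem_ring_iff (h0 _ (inv_ne_zero hu0))).1 h2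
      rw [map_inv₀, v.ord_inv (h0 _ hu0)] at h5
      omega
    have hz : ∀ n : ℤ, v.ord (ρ w.unif ^ n) = n * v.ord (ρ w.unif) := by
      have h6 := h0 _ w.unif_ne_zero
      intro n
      obtain ⟨n, rfl | rfl⟩ := n.eq_nat_or_neg
      · rw [zpow_natCast, v.ord_pow h6]
      · rw [zpow_neg, zpow_natCast, v.ord_inv (pow_ne_zero _ h6), v.ord_pow h6]; ring
    have h7 : g = u * w.unif ^ w.ord g := by
      rw [mul_assoc, ← zpow_add₀ w.unif_ne_zero]; simp
    conv_lhs => rw [h7]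
    rw [map_mul, map_zpow₀, v.ord_mul (h0 _ hu0) (zpow_ne_zero _ (h0 _ w.unif_ne_zero)), h3, hz,
      zero_add]
  by_cases hf : f = 0
  · simp [hf, ord]
  have h1 : v.ord (ρ w.unif) = 1 := by
    have h2 := key (ρ.symm v.unif) (by simpa using v.unif_ne_zero)
    rw [ρ.apply_symm_apply, v.ord_unif] at h2
    have h3 : 0 ≤ v.ord (ρ w.unif) := by
      have := w.unif_mem
      exact (v.mem_ring_iff (h0 _ w.unif_ne_zero)).1 this
    rcases Int.eq_one_or_neg_one_of_mul_eq_one' h2.symm with h | h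
    · exact h.2
    · omega
  rw [key f hf, h1, mul_one]

variable {v}

theorem ord_map_of_comap_eq {ρ : L ≃ₐ[K] L} (h : v.comap ρ = v) (f : L) :
    v.ord (ρ f) = v.ord f := by rw [← v.ord_comap, h]

theorem map_mem_fil_iff {ρ : L ≃ₐ[K] L} (h : v.comap ρ = v) {f : L} {n : ℤ} :
    ρ f ∈ v.fil n ↔ f ∈ v.fil n := by
  by_cases hf : f = 0
  · simp [hf]
  · rw [v.mem_fil hf, v.mem_fil (by simpa using hf), ord_map_of_comap_eq h]

theorem map_mem_fil {ρ : L ≃ₐ[K] L} (h : v.comap ρ = v) {f : L} {n : ℤ} (hf : f ∈ v.fil n) :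
    ρ f ∈ v.fil n := (map_mem_fil_iff h).2 hf

theorem comap_inv_eq {ρ : L ≃ₐ[K] L} (h : v.comap ρ = v) : v.comap ρ⁻¹ = v := by
  conv_lhs => rw [← h]
  rw [← comap_mul, mul_inv_cancel, comap_one]

/-- With `r = c + t s`, one has `ρ r - r = (ρ t - t) ρ s + t (ρ s - s)`, which gains one order per
induction step. -/
theorem sub_mem_fil_of_unif (hv : v.IsRational) {ρ : L ≃ₐ[K] L} (h : v.comap ρ = v) {j : ℕ}
    (hj : ρ v.unif - v.unif ∈ v.fil j) {r : L} (hr : r ∈ v.ring) : ρ r - r ∈ v.fil j := by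
  suffices H : ∀ i : ℕ, i ≤ j → ∀ r ∈ v.ring, ρ r - r ∈ v.fil i from H j le_rfl r hr
  intro i
  induction i with
  | zero =>
    intro _ r hr
    rw [Nat.cast_zero]
    exact sub_mem (map_mem_fil h (v.mem_fil_zero.2 hr)) (v.mem_fil_zero.2 hr)
  | succ i ih =>
    intro hi r hr
    obtain ⟨c, hc⟩ := hv r hr
    rw [mem_fil_def] at hc
    set s := (r - algebraMap K L c) * v.unif ^ (-1 : ℤ) with hs
    have h1 : r = algebraMap K L c + v.unif * s := by
      rw [hs, zpow_neg_one]; field_simp [v.unif_ne_zero]; ring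
    have h2 : ρ r - r = (ρ v.unif - v.unif) * ρ s + v.unif * (ρ s - s) := by
      rw [h1, map_add, map_mul, ρ.commutes]; ring
    rw [h2]
    refine add_mem ?_ ?_
    · exact v.mul_mem_fil_of_eq hj (map_mem_fil h (v.mem_fil_zero.2 hc))
        (by push_cast; omega)
    · refine v.mul_mem_fil_of_eq (v.mem_fil_ord v.unif) (ih (by omega) s hc) ?_
      rw [v.ord_unif]; push_cast; omega

theorem eq_one_of_map_unif (hv : v.IsRational) {ρ : L ≃ₐ[K] L} (h : v.comap ρ = v)
    (hj : ρ v.unif = v.unif) : ρ = 1 := by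
  have h1 : ∀ r ∈ v.ring, ρ r = r := by
    intro r hr
    refine sub_eq_zero.1 (v.eq_zero_of_forall_mem_fil fun n => ?_)
    refine v.fil_anti (Int.self_le_toNat n) (sub_mem_fil_of_unif hv h ?_ hr)
    rw [hj, sub_self]; exact zero_mem _
  ext f
  rcases v.ring.mem_or_inv_mem f with hf | hf
  · exact h1 f hf
  · simpa using h1 _ hf

/-- In a nonzero finite-dimensional space of functions, those of maximal order of vanishing at a
rational place are proportional. -/
theorem IsRational.exists_max_ord (hv : v.IsRational) (W : Submodule K L) [FiniteDimensional K W]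
    (hW : W ≠ ⊥) : ∃ f ∈ W, f ≠ 0 ∧
      ∀ g ∈ W, g ∈ v.fil (v.ord f) → ∃ c : K, g = algebraMap K L c * f := by
  -- The subspaces of `W` vanishing to order `n` form a descending chain. It becomes stationary, and
  -- from there on it is zero, so orders on `W` are bounded.
  obtain ⟨N, hN⟩ := monotone_stabilizes_iff_artinian (R := K) (M := W) |>.2 inferInstance
    ⟨fun n : ℕ => OrderDual.toDual ((v.fil n).comap W.subtype), fun m n hmn =>
      Submodule.comap_mono (v.fil_anti (by exact_mod_cast hmn))⟩
  have hN' : ∀ g ∈ W, g ∈ v.fil N → g = 0 := by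
    intro g hg hgN
    refine v.eq_zero_of_forall_mem_fil fun n => ?_
    have h1 : (v.fil N).comap W.subtype = (v.fil (max N n.toNat : ℕ)).comap W.subtype :=
      hN (max N n.toNat) (le_max_left _ _)
    have h2 : (⟨g, hg⟩ : W) ∈ (v.fil N).comap W.subtype := hgN
    rw [h1] at h2
    exact v.fil_anti (by omega) h2
  obtain ⟨f0, hf0, hf00⟩ := (Submodule.ne_bot_iff W).1 hW
  obtain ⟨m, ⟨f, hf, hf1, rfl⟩, hm⟩ := Int.exists_greatest_of_bdd
    (P := fun m => ∃ f ∈ W, f ≠ 0 ∧ v.ord f = m) ⟨N, by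
      rintro _ ⟨f, hf, hf1, rfl⟩
      by_contra! h
      exact hf1 (hN' f hf ((v.mem_fil hf1).2 h.le))⟩ ⟨_, f0, hf0, hf00, rfl⟩
  refine ⟨f, hf, hf1, fun g hg hgf => ?_⟩
  obtain ⟨c, hc⟩ := hv.exists_sub_mem hf1 hgf
  refine ⟨c, ?_⟩
  by_contra h
  have h0 := sub_ne_zero.2 h
  have h2 := hm _ ⟨g - algebraMap K L c * f, sub_mem hg ?_, h0, rfl⟩
  · rw [v.mem_fil h0] at hc; omega
  · rw [← Algebra.smul_def]; exact W.smul_mem _ hf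

theorem natCast_mem_fil (n : ℕ) : (n : L) ∈ v.fil 0 := by
  simpa using v.algebraMap_mem_fil (n : K)

/-- The first-order expansion of `ρ f / f`, if `ρ` fixes the uniformizer to order `j`. -/
theorem map_div_sub_mem_fil (hv : v.IsRational) {ρ : L ≃ₐ[K] L} (h : v.comap ρ = v) {j : ℕ}
    (hj2 : 2 ≤ j) (hj : ρ v.unif - v.unif ∈ v.fil j) {f : L} (hf : f ≠ 0) {k : ℕ}
    (hk : v.ord f = k) {ε : L} (hε : ρ v.unif = v.unif * (1 + ε)) (hε' : ε ∈ v.fil (j - 1)) :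
    ρ f / f - (1 + k * ε) ∈ v.fil j := by
  have ht := v.unif_ne_zero
  set u := f / v.unif ^ k with hu
  have hu0 : u ≠ 0 := div_ne_zero hf (pow_ne_zero _ ht)
  have hu1 : v.ord u = 0 := by
    rw [hu, v.ord_div hf (pow_ne_zero _ ht), v.ord_pow ht, v.ord_unif, hk]; ring
  have hfu : f = v.unif ^ k * u := by rw [hu]; field_simp
  have h1 : ρ u / u - 1 ∈ v.fil j := by
    have h2 := sub_mem_fil_of_unif hv h hj (r := u) ((v.mem_ring_iff hu0).2 hu1.ge)
    have h3 := v.inv_mem_fil hu0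
    rw [hu1] at h3
    have h4 := v.mul_mem_fil h2 h3
    rwa [neg_zero, add_zero, sub_mul, mul_inv_cancel₀ hu0, ← div_eq_mul_inv] at h4
  have hε0 : ε ∈ v.fil 0 := v.fil_anti (by omega) hε'
  have h5 : (1 + ε) ^ k - (1 + k * ε) ∈ v.fil j := by
    clear hk hu hu0 hu1 hfu h1 u
    induction k with
    | zero => simp
    | succ k ih =>
      have h6 : (1 + ε) ^ (k + 1) - (1 + (k + 1 : ℕ) * ε) =
          ((1 + ε) ^ k - (1 + k * ε)) * (1 + ε) + k * (ε * ε) := by push_cast; ring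
      rw [h6]
      refine add_mem (v.mul_mem_fil_of_eq ih (add_mem v.one_mem_fil hε0) (add_zero _).ge) ?_
      exact v.mul_mem_fil_of_eq (natCast_mem_fil k) (v.mul_mem_fil hε' hε') (by omega)
  have h7 : ρ f / f - (1 + k * ε) =
      ((1 + ε) ^ k - (1 + k * ε)) * (ρ u / u) + (1 + k * ε) * (ρ u / u - 1) := by
    have h8 : ρ f / f = (1 + ε) ^ k * (ρ u / u) := by
      rw [hfu, map_mul, map_pow, hε, mul_pow]
      field_simp
    rw [h8]; ring
  have h9 : ρ u / u ∈ v.fil 0 := by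
    have := add_mem (v.fil_anti (by omega) h1) v.one_mem_fil
    rwa [sub_add_cancel] at this
  rw [h7]
  refine add_mem (v.mul_mem_fil_of_eq h5 h9 (add_zero _).ge) (v.mul_mem_fil_of_eq ?_ h1
    (zero_add _).ge)
  exact add_mem v.one_mem_fil
    (v.mul_mem_fil_of_eq (natCast_mem_fil k) hε0 (add_zero _).ge)

variable [IsAlgClosed K]

/-- Write `ρ t = t + t ^ j w`, so that `ε = t ^ (j - 1) w`, and differentiate; the error is `t ^ j δ
w`, and `δ w` is regular. -/
theorem derivation_map_unif_mem_fil [CharZero L] (hv : v.IsRational) (hL : HasTrdegLEOne K L)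
    (δ : Derivation K L L) (hδ : δ v.unif = 1) {ρ : L ≃ₐ[K] L} {j : ℕ} (hj2 : 1 ≤ j)
    (hj : ρ v.unif - v.unif ∈ v.fil j) {ε : L} (hε : ρ v.unif = v.unif * (1 + ε)) :
    δ (ρ v.unif) - (1 + j * ε) ∈ v.fil j := by
  have ht := v.unif_ne_zero
  rw [mem_fil_def, zpow_neg, zpow_natCast] at hj
  set w := (ρ v.unif - v.unif) * (v.unif ^ j)⁻¹ with hw
  obtain ⟨i, rfl⟩ : ∃ i, j = i + 1 := ⟨j - 1, by omega⟩
  have h1 : ρ v.unif = v.unif + v.unif ^ (i + 1) * w := by rw [hw]; field_simp; ring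
  have h2 : ε = v.unif ^ i * w := by
    rw [hε] at h1
    apply mul_left_cancel₀ ht
    linear_combination h1
  have h3 : δ (ρ v.unif) - (1 + (i + 1 : ℕ) * ε) = v.unif ^ (i + 1) * δ w := by
    rw [h1, map_add, δ.leibniz, δ.leibniz_pow, hδ, h2]
    simp only [smul_eq_mul, nsmul_eq_mul, Nat.add_sub_cancel]
    ring
  rw [h3]
  refine v.mul_mem_fil_of_eq (v.pow_mem_fil (v.mem_fil_ord _) _)
    (v.mem_fil_zero.2 (derivation_mem hv hL δ hδ hj)) ?_
  rw [v.ord_unif]; simp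

/-- If an automorphism of a field of functions of positive genus fixes a rational place and acts
trivially on its cotangent space, then it is the identity. -/
theorem eq_one_of_genus_pos [CharZero K] (hL : HasTrdegLEOne K L)
    (hg : 1 ≤ functionFieldGenus K L) {ρ : L ≃ₐ[K] L} (h : v.comap ρ = v)
    (h2 : ρ v.unif - v.unif ∈ v.fil 2) : ρ = 1 := by
  have : CharZero L := charZero_of_injective_algebraMap (algebraMap K L).injective
  have hv := hL.isRational v
  have ht := v.unif_ne_zero
  set V : Submodule K (Ω[L⁄K]) := ⨅ v : Place K L, v.regularAt with hV
  -- `finrank` is 0 on infinite-dimensional spaces, so positive genus includes finiteness.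
  have hVfin : FiniteDimensional K V := Module.finite_of_finrank_pos (by
    rw [functionFieldGenus, ← hV] at hg; omega)
  have hVne : V ≠ ⊥ := by
    intro hb
    rw [functionFieldGenus, ← hV, hb, finrank_bot] at hg
    omega
  obtain ⟨ω, hω, hω0⟩ := (Submodule.ne_bot_iff V).1 hVne
  have : Nontrivial (Ω[L⁄K]) := ⟨ω, 0, hω0⟩
  obtain ⟨e, he⟩ := v.exists_kaehler_equiv hL
  set D := KaehlerDifferential.D K L
  set δ : Derivation K L L := e.toLinearMap.compDer D with hδdef
  have hδe : ∀ g, e (D g) = δ g := fun g => rfl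
  have hδ : δ v.unif = 1 := he
  have heD : ∀ f, e (f • D v.unif) = f := fun f => by rw [map_smul, he, smul_eq_mul, mul_one]
  have hDδ : ∀ g, D g = δ g • D v.unif := fun g => e.injective (by rw [heD]; rfl)
  -- The chain rule: the conjugate of `δ` by `ρ` is again a derivation, hence a multiple of `δ`.
  have hchain : ∀ g, δ (ρ g) = ρ (δ g) * δ (ρ v.unif) := by
    let δ' : Derivation K L L := Derivation.mk'
      ((ρ.symm.toLinearMap.comp (δ : L →ₗ[K] L)).comp ρ.toLinearMap) (by
        intro a b
        simp [δ.leibniz])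
    have hδ' : ∀ g, δ' g = ρ.symm (δ (ρ g)) := fun g => rfl
    intro g
    have h1 : δ' g = δ g * δ' v.unif := by
      rw [← δ'.liftKaehlerDifferential_comp_D, hDδ g, map_smul,
        δ'.liftKaehlerDifferential_comp_D, smul_eq_mul]
    rw [hδ', hδ'] at h1
    simpa using congrArg ρ h1
  let e' : Ω[L⁄K] ≃ₗ[K] L := e.restrictScalars K
  -- `W` consists of the `f` for which `f dt` is regular everywhere, and `T` below is the pullback
  -- by `ρ` in terms of `f`.
  let W : Submodule K L := V.map e'.toLinearMap
  have hWfin : FiniteDimensional K W := inferInstance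
  have hWne : W ≠ ⊥ := by
    intro hb
    have h1 : e' ω ∈ W := ⟨ω, hω, rfl⟩
    rw [hb, Submodule.mem_bot] at h1
    exact hω0 (e'.map_eq_zero_iff.1 h1)
  have hWmem : ∀ f, f ∈ W ↔ ∀ w : Place K L, f • D v.unif ∈ w.regularAt := by
    intro f
    rw [← Submodule.mem_iInf]
    constructor
    · rintro ⟨ω, hω, rfl⟩
      have : e' ω • D v.unif = ω := e.injective (heD _)
      change e' ω • D v.unif ∈ _
      rw [this]; exact hω
    · intro hf; exact ⟨_, hf, heD f⟩
  let T : L →ₗ[K] L := (LinearMap.mulRight K (δ (ρ v.unif))).comp ρ.toLinearMap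
  have hTdef : ∀ f, T f = ρ f * δ (ρ v.unif) := fun f => rfl
  have hTW : ∀ f ∈ W, T f ∈ W := by
    intro f hf
    rw [hWmem] at hf ⊢
    intro w
    -- The pullback is regular at `w` because `f dt` is regular at the place `w.comap ρ`.
    have h1 := hf (w.comap ρ)
    have h3 : (w.comap ρ).regularAt ≤
        (w.regularAt.comap e'.symm.toLinearMap).comap (T.comp e'.toLinearMap) := by
      refine Submodule.span_le.2 ?_
      rintro _ ⟨a, ha, b, hb, rfl⟩
      refine Submodule.subset_span ⟨ρ a, ha, ρ b, hb, ?_⟩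
      apply e.injective
      refine (e.apply_symm_apply _).trans ?_
      change T (e (a • D b)) = e (ρ a • D (ρ b))
      have h6 : ∀ x y, e (x • D y) = x * δ y := fun x y => map_smul e x (D y)
      rw [h6, h6, hTdef, hchain b, map_mul, mul_assoc]
    have h4 := h3 h1
    have h5 : e'.symm (T (e' (f • D v.unif))) ∈ w.regularAt := h4
    have h6 : e' (f • D v.unif) = f := heD f
    rw [h6] at h5
    have h7 : e'.symm (T f) = T f • D v.unif := e.injective ((e.apply_symm_apply _).trans
      (heD _).symm)
    rwa [h7] at h5
  have hWR : ∀ f ∈ W, f ∈ v.fil 0 := by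
    intro f hf
    rw [hWmem] at hf
    have h3 : v.regularAt ≤ (v.fil 0).comap e'.toLinearMap := by
      refine Submodule.span_le.2 ?_
      rintro _ ⟨a, ha, b, hb, rfl⟩
      change e (a • D b) ∈ v.fil 0
      rw [map_smul, hδe, smul_eq_mul, mem_fil_zero]
      exact v.ring.mul_mem _ _ ha (derivation_mem hv hL δ hδ hb)
    have h4 : e (f • D v.unif) ∈ v.fil 0 := h3 (hf v)
    rwa [heD] at h4
  obtain ⟨f, hf, hf0, hmax⟩ := hv.exists_max_ord W hWne
  obtain ⟨k, hk⟩ : ∃ k : ℕ, v.ord f = k :=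
    ⟨_, (Int.toNat_of_nonneg ((v.mem_fil hf0).1 (hWR f hf))).symm⟩
  set ε := ρ v.unif / v.unif - 1 with hεdef
  have hε : ρ v.unif = v.unif * (1 + ε) := by rw [hεdef]; field_simp; ring
  have hεfil : ∀ j : ℕ, ρ v.unif - v.unif ∈ v.fil j ↔ ε ∈ v.fil (j - 1) := by
    intro j
    have h1 : ρ v.unif - v.unif = v.unif * ε := by rw [hε]; ring
    rw [h1]
    by_cases h0 : ε = 0
    · simp [h0]
    rw [v.mem_fil h0, v.mem_fil (mul_ne_zero ht h0), v.ord_mul ht h0, v.ord_unif]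
    omega
  have hexp : ∀ j : ℕ, 2 ≤ j → ρ v.unif - v.unif ∈ v.fil j →
      ρ f / f - (1 + k * ε) ∈ v.fil j ∧ δ (ρ v.unif) - (1 + j * ε) ∈ v.fil j := fun j hj hj' =>
    ⟨map_div_sub_mem_fil hv h hj hj' hf0 hk hε ((hεfil j).1 hj'),
      derivation_map_unif_mem_fil hv hL δ hδ (by omega) hj' hε⟩
  -- `T f` lies in `W` and has at least the order of `f`, so `T f = c f` by maximality; since `ρ t ≡
  -- t` modulo `t ^ 2`, the leading coefficients agree and `c = 1`.
  have hTf : ρ f / f * δ (ρ v.unif) = 1 := by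
    obtain ⟨h3, h4⟩ := hexp 2 le_rfl h2
    have hε1 : ε ∈ v.fil 1 := (hεfil 2).1 h2
    have h5 : ∀ n : ℕ, (n : L) * ε ∈ v.fil 1 := fun n =>
      v.mul_mem_fil_of_eq (natCast_mem_fil n) hε1 (by norm_num)
    have h6 : ρ f / f - 1 ∈ v.fil 1 := by
      have := add_mem (v.fil_anti (by norm_num) h3) (h5 k)
      convert this using 1; ring
    have h7 : δ (ρ v.unif) - 1 ∈ v.fil 1 := by
      have := add_mem (v.fil_anti (by norm_num) h4) (h5 2)
      convert this using 1; ring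
    have h8 : ρ f / f * δ (ρ v.unif) - 1 ∈ v.fil 1 := by
      have h9 : ρ f / f ∈ v.fil 0 := by
        have := add_mem (v.fil_anti (by norm_num) h6) v.one_mem_fil
        rwa [sub_add_cancel] at this
      have := add_mem (v.mul_mem_fil_of_eq h9 h7 (zero_add _).ge) h6
      convert this using 1; ring
    have h10 : T f = ρ f / f * δ (ρ v.unif) * f := by rw [hTdef]; field_simp
    obtain ⟨c, hc⟩ := hmax (T f) (hTW f hf) (by
      rw [h10]
      have h11 : ρ f / f * δ (ρ v.unif) ∈ v.fil 0 := by
        have := add_mem (v.fil_anti (by norm_num) h8) v.one_mem_fil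
        rwa [sub_add_cancel] at this
      exact v.mul_mem_fil_of_eq h11 (v.mem_fil_ord f) (zero_add _).ge)
    rw [h10] at hc
    have h12 := mul_right_cancel₀ hf0 hc
    rw [h12] at h8 ⊢
    have h13 : algebraMap K L (c - 1) ∈ v.fil 1 := by simpa using h8
    have h14 := v.eq_zero_of_algebraMap_mem_fil one_pos h13
    rw [sub_eq_zero.1 h14, map_one]
  have hstep : ∀ j : ℕ, ρ v.unif - v.unif ∈ v.fil (j + 2 : ℕ) := by
    intro j
    induction j with
    | zero => exact h2
    | succ j ih =>
      set i := j + 2 with hi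
      obtain ⟨h3, h4⟩ := hexp i (by omega) ih
      have hε1 := (hεfil i).1 ih
      set α := ρ f / f - (1 + k * ε) with hα
      set β := δ (ρ v.unif) - (1 + i * ε) with hβ
      have hα' : ρ f / f = 1 + k * ε + α := by rw [hα]; ring
      have hβ' : δ (ρ v.unif) = 1 + i * ε + β := by rw [hβ]; ring
      rw [hα', hβ'] at hTf
      -- Multiplying out the two expansions in `hTf` leaves `(k + i) ε` equal to terms of order at
      -- least `i`; the quadratic term has order at least `2 (i - 1) ≥ i`.
      have h5 : ((k + i : ℕ) : L) * ε =
          -(α * (1 + i * ε + β) + (1 + k * ε) * β + (k * i : ℕ) * (ε * ε)) := by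
        push_cast
        linear_combination hTf
      have hε0 : ε ∈ v.fil 0 := v.fil_anti (by omega) hε1
      have hn : ∀ n : ℕ, (1 : L) + n * ε ∈ v.fil 0 := fun n => add_mem v.one_mem_fil
        (v.mul_mem_fil_of_eq (natCast_mem_fil n) hε0 (add_zero _).ge)
      have h6 : ((k + i : ℕ) : L) * ε ∈ v.fil i := by
        rw [h5]
        refine neg_mem (add_mem (add_mem ?_ ?_) ?_)
        · exact v.mul_mem_fil_of_eq h3 (add_mem (hn i) (v.fil_anti (by omega) h4))
            (add_zero _).ge
        · exact v.mul_mem_fil_of_eq (hn k) h4 (zero_add _).ge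
        · exact v.mul_mem_fil_of_eq (natCast_mem_fil _) (v.mul_mem_fil hε1 hε1) (by omega)
      have h7 : ((k + i : ℕ) : K) ≠ 0 := by
        rw [Nat.cast_ne_zero]; omega
      have h8 : ((k + i : ℕ) : K) • ε ∈ v.fil i := by
        rw [Algebra.smul_def]; simpa using h6
      have h9 := (Submodule.smul_mem_iff _ h7).1 h8
      have : ((j + 1 + 2 : ℕ) : ℤ) = (i : ℤ) + 1 := by omega
      rw [hεfil, this, add_sub_cancel_right]
      exact h9
  refine eq_one_of_map_unif hv h (sub_eq_zero.1 (v.eq_zero_of_forall_mem_fil fun n => ?_))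
  exact v.fil_anti (by omega) (hstep n.toNat)

end Place

end

/-! ### Weak approximation and decomposition groups -/

section

open Polynomial

namespace Place

variable {K L : Type*} [Field K] [Field L] [Algebra K L] {v w : Place K L}

/-- Discrete valuation rings are maximal: if `v.ring` were properly inside `w.ring`, some `f` in
`w.ring` would have a pole at `v`. Dividing any `g` by a high power of `f` lands in `v.ring`, so
`w.ring` would be all of `L`. -/
theorem exists_mem_notMem (h : v ≠ w) : ∃ f, f ∈ v.ring ∧ f ∉ w.ring := by
  by_contra! hle
  have h1 : ¬ w.ring ≤ v.ring := fun h2 => h (ext_ring (le_antisymm hle h2))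
  obtain ⟨f, hf, hfv⟩ := SetLike.not_le_iff_exists.1 h1
  have hf0 : f ≠ 0 := by rintro rfl; exact hfv (zero_mem _)
  rw [v.mem_ring_iff hf0] at hfv
  have hw := w.unif_ne_zero
  have hall : ∀ g, g ∈ w.ring := by
    intro g
    by_cases hg : g = 0
    · rw [hg]; exact zero_mem _
    set n := (v.ord g).natAbs
    have h3 : g * (f ^ n)⁻¹ ∈ v.ring := by
      have h4 : f ^ n ≠ 0 := pow_ne_zero _ hf0
      rw [v.mem_ring_iff (mul_ne_zero hg (inv_ne_zero h4)), v.ord_mul hg (inv_ne_zero h4),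
        v.ord_inv h4, v.ord_pow hf0]
      have h5 : (n : ℤ) ≤ n * -v.ord f := le_mul_of_one_le_right (by positivity) (by omega)
      have h6 : -(n : ℤ) ≤ v.ord g := by omega
      linarith
    have h7 := w.ring.mul_mem _ _ (hle _ h3) (pow_mem hf n)
    rwa [inv_mul_cancel_right₀ (pow_ne_zero _ hf0)] at h7
  exact w.unif_inv_notMem (hall _)

theorem exists_mem_fil_one_notMem (h : v ≠ w) : ∃ z, z ∈ v.fil 1 ∧ z ∉ w.ring := by
  obtain ⟨a, hav, haw⟩ := exists_mem_notMem h
  obtain ⟨b, hbw, hbv⟩ := exists_mem_notMem h.symm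
  have ha : a ≠ 0 := by rintro rfl; exact haw (zero_mem _)
  have hb : b ≠ 0 := by rintro rfl; exact hbv (zero_mem _)
  have hab : a / b ≠ 0 := div_ne_zero ha hb
  rw [mem_ring_iff _ ha] at hav haw
  rw [mem_ring_iff _ hb] at hbv hbw
  refine ⟨a / b, ?_, ?_⟩
  · rw [v.mem_fil hab, v.ord_div ha hb]; omega
  · rw [w.mem_ring_iff hab, w.ord_div ha hb]; omega

theorem one_notMem_fil_one : (1 : L) ∉ v.fil 1 := by
  rw [v.mem_fil one_ne_zero, ord_one]; omega

theorem exists_sub_one_mem_and_mem [Infinite K] (S : Finset (Place K L)) (h : v ≠ w) :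
    ∃ y, y - 1 ∈ v.fil 1 ∧ y ∈ w.fil 1 ∧ ∀ s ∈ S, y ∈ s.fil 0 := by
  classical
  obtain ⟨z, hzv, hzw⟩ := exists_mem_fil_one_notMem h
  have hbad : ∀ s : Place K L, {c : K | 1 + c • z ∈ s.fil 1}.Subsingleton := by
    intro s c hc c' hc'
    by_contra hne
    replace hc : 1 + c • z ∈ s.fil 1 := hc
    replace hc' : 1 + c' • z ∈ s.fil 1 := hc'
    have h1 := sub_mem hc hc'
    rw [add_sub_add_left_eq_sub, ← sub_smul, Submodule.smul_mem_iff _ (sub_ne_zero.2 hne)] at h1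
    have h2 := sub_mem hc (Submodule.smul_mem _ c h1)
    rw [add_sub_cancel_right] at h2
    exact one_notMem_fil_one h2
  -- Each place of `S` excludes at most one `c`, and `K` is infinite. The function sought is `1 / (1
  -- + c z)`, which is 1 at `v`, zero at the pole `w` of `z`, and regular on `S`.
  obtain ⟨c, hc⟩ := (((Set.finite_singleton (0 : K)).union
    (S.finite_toSet.biUnion fun s _ => (hbad s).finite)).infinite_compl).nonempty
  simp only [Set.mem_compl_iff, Set.mem_union, Set.mem_singleton_iff, Set.mem_iUnion, not_or,
    not_exists, Set.mem_ofPred_eq, SetLike.mem_coe] at hc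
  obtain ⟨hc0, hcS⟩ := hc
  have hcv : c • z ∈ v.fil 1 := Submodule.smul_mem _ _ hzv
  obtain ⟨h0, h1⟩ := v.ord_eq_zero_of_sub_algebraMap_mem (f := 1 + c • z) (c := 1) one_ne_zero
    (by simpa using hcv)
  refine ⟨(1 + c • z)⁻¹, ?_, ?_, ?_⟩
  · have h2 : (1 + c • z)⁻¹ - 1 = -((1 + c • z)⁻¹ * (c • z)) := by field_simp; ring
    rw [h2, neg_mem_iff]
    exact v.mul_mem_fil_of_eq (v.inv_mem_fil h0) hcv (by rw [h1]; norm_num)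
  · rw [w.mem_fil (inv_ne_zero h0), w.ord_inv h0]
    have h3 : ¬ (1 + c • z ∈ w.fil 0) := by
      intro h3
      have h4 := sub_mem h3 w.one_mem_fil
      rw [add_sub_cancel_left, Submodule.smul_mem_iff _ hc0, mem_fil_zero] at h4
      exact hzw h4
    rw [w.mem_fil h0] at h3
    omega
  · intro s hs
    have h3 := hcS s hs
    rw [s.mem_fil h0] at h3
    rw [s.mem_fil (inv_ne_zero h0), s.ord_inv h0]
    omega

theorem prod_sub_one_mem {ι : Type*} (S : Finset ι) (y : ι → L)
    (h : ∀ i ∈ S, y i - 1 ∈ v.fil 1) : ∏ i ∈ S, y i - 1 ∈ v.fil 1 := by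
  classical
  induction S using Finset.induction_on with
  | empty => simp
  | insert a S ha ih =>
    have h1 := ih fun i hi => h i (by simp [hi])
    have h2 := h a (by simp)
    rw [Finset.prod_insert ha]
    have h3 : y a * ∏ i ∈ S, y i - 1 =
        (y a - 1) * (∏ i ∈ S, y i - 1) + (y a - 1) + (∏ i ∈ S, y i - 1) := by ring
    rw [h3]
    exact add_mem (add_mem (v.mul_mem_fil_of_eq h2 h1 (by norm_num)) h2) h1

theorem prod_mem_fil_zero {ι : Type*} (S : Finset ι) (y : ι → L)
    (h : ∀ i ∈ S, y i ∈ v.fil 0) : ∏ i ∈ S, y i ∈ v.fil 0 := by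
  simp only [mem_fil_zero] at *
  exact prod_mem h

/-- Weak approximation: there is a function with a simple zero at `v` and of order zero at
finitely many other places. -/
theorem exists_ord_eq_one [Infinite K] (v : Place K L) (S : Finset (Place K L))
    (hS : ∀ w ∈ S, v ≠ w) : ∃ x : L, x ≠ 0 ∧ v.ord x = 1 ∧ ∀ w ∈ S, w.ord x = 0 := by
  classical
  have hy : ∀ w : Place K L, ∃ y, v ≠ w →
      y - 1 ∈ v.fil 1 ∧ y ∈ w.fil 1 ∧ ∀ s ∈ S, y ∈ s.fil 0 := by
    intro w
    by_cases h : v = w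
    · exact ⟨0, fun h' => absurd h h'⟩
    · obtain ⟨y, hy⟩ := exists_sub_one_mem_and_mem S h; exact ⟨y, fun _ => hy⟩
  choose y hy using hy
  set Y := ∏ w ∈ S, y w with hYdef
  have hYv : Y - 1 ∈ v.fil 1 := prod_sub_one_mem S y fun w hw => (hy w (hS w hw)).1
  have hYw : ∀ w ∈ S, Y ∈ w.fil 1 := by
    intro w hw
    rw [hYdef, ← Finset.mul_prod_erase S y hw]
    refine w.mul_mem_fil_of_eq (hy w (hS w hw)).2.1 (prod_mem_fil_zero _ _ fun s hs => ?_)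
      (add_zero _).ge
    exact (hy s (hS s (Finset.mem_of_mem_erase hs))).2.2 w hw
  set t := v.unif with htdef
  -- `Y` is 1 at `v` and 0 on `S`. With `N` large enough to absorb the poles of `t` on `S`, the
  -- function `t Y ^ N + (1 - Y) ^ N` is close to `t` at `v` and to 1 on `S`.
  set N : ℕ := 2 + ∑ w ∈ S, (w.ord t).natAbs with hN
  have hNw : ∀ w ∈ S, 2 - w.ord t ≤ N := by
    intro w hw
    have := Finset.single_le_sum (f := fun w : Place K L => (w.ord t).natAbs)
      (fun _ _ => Nat.zero_le _) hw
    omega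
  have hpow : ∀ {s : Place K L} {f : L}, f - 1 ∈ s.fil 1 → f ^ N - 1 ∈ s.fil 1 := by
    intro s f hf
    have := prod_sub_one_mem (v := s) (Finset.range N) (fun _ => f) (fun _ _ => hf)
    simpa using this
  have hxv : t * Y ^ N + (1 - Y) ^ N - t ∈ v.fil (v.ord t + 1) := by
    have h1 : t * Y ^ N + (1 - Y) ^ N - t = t * (Y ^ N - 1) + (1 - Y) ^ N := by ring
    rw [h1]
    refine add_mem (v.mul_mem_fil_of_eq (v.mem_fil_ord t) (hpow hYv) le_rfl) ?_
    have h2 : 1 - Y ∈ v.fil 1 := by rw [← neg_sub]; exact neg_mem hYv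
    refine v.fil_anti ?_ (v.pow_mem_fil h2 N)
    rw [htdef, v.ord_unif]; omega
  refine ⟨t * Y ^ N + (1 - Y) ^ N, v.ne_zero_of_sub_mem v.unif_ne_zero hxv, ?_, ?_⟩
  · rw [v.ord_eq_of_sub_mem v.unif_ne_zero hxv, v.ord_unif]
  · intro w hw
    refine (w.ord_eq_zero_of_sub_algebraMap_mem (c := 1) one_ne_zero ?_).2
    rw [map_one, add_sub_assoc]
    refine add_mem (w.mul_mem_fil_of_eq (w.mem_fil_ord t) (w.pow_mem_fil (hYw w hw) N) ?_)
      (hpow ?_)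
    · have := hNw w hw; omega
    · rw [sub_sub_cancel_left]; exact neg_mem (hYw w hw)

theorem ord_dvd_of_mem_adjoin {u : L} (hu : 0 < v.ord u) (hu0 : u ≠ 0) {y : L} (hy0 : y ≠ 0)
    (hy : y ∈ IntermediateField.adjoin K {u}) : v.ord u ∣ v.ord y := by
  obtain ⟨r, s, rfl⟩ := (IntermediateField.mem_adjoin_simple_iff K y).1 hy
  have hr : r ≠ 0 := by rintro rfl; simp at hy0
  have hs : s ≠ 0 := by rintro rfl; simp at hy0
  obtain ⟨hr0, hr1⟩ := v.ord_aeval hu hu0 hr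
  obtain ⟨hs0, hs1⟩ := v.ord_aeval hu hu0 hs
  rw [v.ord_div hr0 hs0, hr1, hs1]
  exact dvd_sub (dvd_mul_left _ _) (dvd_mul_left _ _)

/-- The decomposition group of a place over an intermediate field. -/
def decompositionGroup (v : Place K L) (M : IntermediateField K L) : Subgroup (L ≃ₐ[M] L) where
  carrier := {σ | v.comap (σ.restrictScalars K) = v}
  one_mem' := v.comap_one
  mul_mem' {σ τ} hσ hτ := by
    have h : (σ * τ).restrictScalars K = σ.restrictScalars K * τ.restrictScalars K := rfl
    simp only [Set.mem_ofPred_eq] at *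
    rw [h, comap_mul, hσ, hτ]
  inv_mem' {σ} hσ := comap_inv_eq hσ

theorem mem_decompositionGroup {M : IntermediateField K L} {σ : L ≃ₐ[M] L} :
    σ ∈ v.decompositionGroup M ↔ v.comap (σ.restrictScalars K) = v := Iff.rfl

/-- Take the norm to `M` of a function with a simple zero at `v` and order 0 at the other conjugate
places. Exactly the conjugates by the decomposition group contribute to its order at `v`, and orders
of elements of `K(u)` are multiples of `v.ord u`. -/
theorem ord_dvd_card_decompositionGroup [Infinite K] (v : Place K L) {u : L} (hu : 0 < v.ord u)
    (hu0 : u ≠ 0) {M : IntermediateField K L} (hM : M = IntermediateField.adjoin K {u})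
    [FiniteDimensional M L] [IsGalois M L] :
    v.ord u ∣ (Nat.card (v.decompositionGroup M) : ℤ) := by
  classical
  obtain ⟨x, hx0, hx1, hx⟩ := v.exists_ord_eq_one
    ((Finset.univ.image fun σ : L ≃ₐ[M] L => v.comap (σ.restrictScalars K)).filter (v ≠ ·))
    (fun w hw => (Finset.mem_filter.1 hw).2)
  have hprod := Algebra.norm_eq_prod_automorphisms (K := M) x
  have h0 : ∀ σ ∈ (Finset.univ : Finset (L ≃ₐ[M] L)), σ x ≠ 0 := fun σ _ => by simpa using hx0
  have h1 : v.ord (∏ σ : L ≃ₐ[M] L, σ x) = Nat.card (v.decompositionGroup M) := by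
    rw [v.ord_prod _ _ h0]
    have h2 : ∀ σ : L ≃ₐ[M] L, v.ord (σ x) = if σ ∈ v.decompositionGroup M then 1 else 0 := by
      intro σ
      have h3 : v.ord (σ x) = (v.comap (σ.restrictScalars K)).ord x :=
        (v.ord_comap (σ.restrictScalars K) x).symm
      rw [h3]
      split_ifs with h
      · rw [mem_decompositionGroup.1 h, hx1]
      · refine hx _ (Finset.mem_filter.2 ⟨Finset.mem_image_of_mem _ (Finset.mem_univ σ), ?_⟩)
        exact fun h4 => h h4.symm
    rw [Finset.sum_congr rfl fun σ _ => h2 σ, Finset.sum_boole, Nat.card_eq_fintype_card,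
      Fintype.card_subtype]
  rw [← h1]
  refine ord_dvd_of_mem_adjoin hu hu0 (Finset.prod_ne_zero_iff.2 h0) ?_
  rw [← hM, ← hprod]
  exact (Algebra.norm M x).2

theorem pow_multiplier {ρ : L ≃ₐ[K] L} (h : v.comap ρ = v) {c : K}
    (hc : ρ v.unif - c • v.unif ∈ v.fil 2) (n : ℕ) :
    (ρ ^ n) v.unif - c ^ n • v.unif ∈ v.fil 2 := by
  induction n with
  | zero => simp
  | succ n ih =>
    have h1 := add_mem (map_mem_fil h ih) (Submodule.smul_mem _ (c ^ n) hc)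
    rw [map_sub, map_smul, smul_sub, sub_add_sub_cancel, smul_smul, ← pow_succ] at h1
    rwa [pow_succ']

theorem exists_multiplier (hv : v.IsRational) {ρ : L ≃ₐ[K] L} (h : v.comap ρ = v) :
    ∃ c : K, ρ v.unif - c • v.unif ∈ v.fil 2 := by
  have h1 := map_mem_fil h (v.mem_fil_ord v.unif)
  obtain ⟨c, hc⟩ := hv.exists_sub_mem v.unif_ne_zero h1
  rw [ord_unif, ← Algebra.smul_def] at hc
  exact ⟨c, hc⟩

theorem multiplier_unique {c c' : K} {f : L} (h : f - c • v.unif ∈ v.fil 2)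
    (h' : f - c' • v.unif ∈ v.fil 2) : c = c' := by
  by_contra hne
  have h1 := sub_mem h' h
  rw [sub_sub_sub_cancel_left, ← sub_smul, Submodule.smul_mem_iff _ (sub_ne_zero.2 hne),
    v.mem_fil v.unif_ne_zero, ord_unif] at h1
  omega

variable [IsAlgClosed K] [CharZero K]

theorem eq_of_multiplier_eq (hL : HasTrdegLEOne K L) (hg : 1 ≤ functionFieldGenus K L)
    {ρ τ : L ≃ₐ[K] L} (hρ : v.comap ρ = v) (hτ : v.comap τ = v) {c : K}
    (h1 : ρ v.unif - c • v.unif ∈ v.fil 2) (h2 : τ v.unif - c • v.unif ∈ v.fil 2) : ρ = τ := by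
  have h3 := sub_mem h2 h1
  rw [sub_sub_sub_cancel_right] at h3
  have h4 := map_mem_fil (comap_inv_eq hρ) h3
  have h5 : ρ⁻¹ (τ v.unif - ρ v.unif) = (ρ⁻¹ * τ) v.unif - v.unif := by
    rw [map_sub]; congr 1; exact ρ.symm_apply_apply _
  rw [h5] at h4
  have h6 := eq_one_of_genus_pos hL hg (by rw [comap_mul, comap_inv_eq hρ, hτ]) h4
  exact (inv_mul_eq_one.1 h6)

/-- The multiplier embeds the decomposition group, of order `n`, into the `n`-th roots of unity.
There are at most `n` of these, so all are attained; `ζ` is one of them because `e` divides `n`. -/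
theorem exists_mem_decompositionGroup (hL : HasTrdegLEOne K L)
    (hg : 1 ≤ functionFieldGenus K L) (v : Place K L) {u : L} (hu : 0 < v.ord u)
    (hu0 : u ≠ 0) {M : IntermediateField K L} (hM : M = IntermediateField.adjoin K {u})
    [FiniteDimensional M L] [IsGalois M L] {e : ℕ} (he : v.ord u = e) {ζ : K} (hζ : ζ ^ e = 1) :
    ∃ σ ∈ v.decompositionGroup M, σ v.unif - ζ • v.unif ∈ v.fil 2 := by
  classical
  have hdvd := v.ord_dvd_card_decompositionGroup hu hu0 hM
  set D := v.decompositionGroup M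
  set n := Nat.card D with hn
  rw [he, Int.natCast_dvd_natCast] at hdvd
  have hn0 : 0 < n := Nat.card_pos
  have hχ : ∀ σ : D, ∃ c : K, σ.1 v.unif - c • v.unif ∈ v.fil 2 := fun σ =>
    exists_multiplier (hL.isRational v) (mem_decompositionGroup.1 σ.2)
  choose χ hχ using hχ
  have hinj : Function.Injective χ := by
    intro σ τ h
    have h1 : σ.1.restrictScalars K = τ.1.restrictScalars K :=
      eq_of_multiplier_eq hL hg (mem_decompositionGroup.1 σ.2) (mem_decompositionGroup.1 τ.2)
        (hχ σ) (h ▸ hχ τ)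
    exact Subtype.ext (AlgEquiv.restrictScalars_injective K h1)
  have hroot : ∀ σ, χ σ ^ n = 1 := by
    intro σ
    have h1 := pow_multiplier (ρ := σ.1.restrictScalars K) (mem_decompositionGroup.1 σ.2)
      (hχ σ) n
    have h2 : (σ.1.restrictScalars K) ^ n = 1 := by
      have h3 : σ ^ n = 1 := pow_card_eq_one'
      have h4 : σ.1 ^ n = 1 := congrArg Subtype.val h3
      have h5 : ∀ m : ℕ, (σ.1.restrictScalars K) ^ m = (σ.1 ^ m).restrictScalars K := by
        intro m
        induction m with
        | zero => rfl
        | succ m ih => rw [pow_succ, pow_succ, ih]; rfl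
      rw [h5, h4]; rfl
    rw [h2] at h1
    exact multiplier_unique h1 (by simp)
  have himg : Finset.univ.image χ = nthRootsFinset n (1 : K) := by
    refine Finset.eq_of_subset_of_card_le ?_ ?_
    · intro c hc
      obtain ⟨σ, -, rfl⟩ := Finset.mem_image.1 hc
      exact (mem_nthRootsFinset hn0 1).2 (hroot σ)
    · rw [Finset.card_image_of_injective _ hinj, Finset.card_univ, ← Nat.card_eq_fintype_card,
        nthRootsFinset_def]
      exact (Multiset.toFinset_card_le _).trans (card_nthRoots n 1)
  have hmem : ζ ∈ Finset.univ.image χ := by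
    rw [himg, mem_nthRootsFinset hn0]
    obtain ⟨k, hk⟩ := hdvd
    rw [hk, pow_mul, hζ, one_pow]
  obtain ⟨σ, -, rfl⟩ := Finset.mem_image.1 hmem
  exact ⟨σ, σ.2, hχ σ⟩

/-- Two subfields `K(u₁)` and `K(u₂)` over which a function field of positive genus is Galois
and which generate it have different ramification indices at every place where both ramify. -/
theorem ord_ne_ord_of_isGalois (hL : HasTrdegLEOne K L)
    (hg : 1 ≤ functionFieldGenus K L) (v : Place K L) {u₁ u₂ : L} (hu₁ : u₁ ≠ 0) (hu₂ : u₂ ≠ 0)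
    (h2 : 2 ≤ v.ord u₁) {M₁ M₂ : IntermediateField K L}
    (hM₁ : M₁ = IntermediateField.adjoin K {u₁}) (hM₂ : M₂ = IntermediateField.adjoin K {u₂})
    [FiniteDimensional M₁ L] [IsGalois M₁ L] [FiniteDimensional M₂ L] [IsGalois M₂ L]
    (htop : M₁ ⊔ M₂ = ⊤) : v.ord u₁ ≠ v.ord u₂ := by
  intro heq
  obtain ⟨e, he⟩ : ∃ e : ℕ, v.ord u₁ = e := ⟨_, (Int.toNat_of_nonneg (by omega)).symm⟩
  have : NeZero e := ⟨by omega⟩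
  obtain ⟨ζ, hζ⟩ := HasEnoughRootsOfUnity.exists_primitiveRoot K e
  obtain ⟨σ, hσ, hσ'⟩ := exists_mem_decompositionGroup hL hg v (by omega) hu₁ hM₁ he hζ.pow_eq_one
  obtain ⟨τ, hτ, hτ'⟩ := exists_mem_decompositionGroup hL hg v (by omega) hu₂ hM₂ (heq ▸ he)
    hζ.pow_eq_one
  have h3 : σ.restrictScalars K = τ.restrictScalars K := eq_of_multiplier_eq hL hg hσ hτ hσ' hτ'
  have h4 : σ.restrictScalars K ∈ (M₁ ⊔ M₂).fixingSubgroup := by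
    rw [IntermediateField.fixingSubgroup_sup]
    refine ⟨fun x => σ.commutes x, ?_⟩
    rw [h3]
    exact fun x => τ.commutes x
  rw [htop, IntermediateField.fixingSubgroup_top, Subgroup.mem_bot] at h4
  have h5 : σ v.unif = v.unif := congrArg (fun ρ : L ≃ₐ[K] L => ρ v.unif) h4
  have h6 : ζ = 1 := multiplier_unique hσ' (by rw [h5]; simp)
  have h7 := hζ.eq_orderOf
  rw [h6, orderOf_one] at h7
  omega

end Place

end

/-! ### Linear forms and projection fields -/

section

open MvPolynomial Matrix

theorem MvPolynomial.aeval_mul_left_of_isHomogeneous {K A σ : Type*} [CommRing K] [CommRing A]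
    [Algebra K A] {n : ℕ} {a : MvPolynomial σ K} (ha : a.IsHomogeneous n) (r : A) (y : σ → A) :
    MvPolynomial.aeval (fun i => r * y i) a = r ^ n * MvPolynomial.aeval y a := by
  rw [aeval_def, aeval_def, eval₂_eq, eval₂_eq, Finset.mul_sum]
  refine Finset.sum_congr rfl fun m hm => ?_
  have h1 : ∏ i ∈ m.support, (r * y i) ^ m i = r ^ n * ∏ i ∈ m.support, y i ^ m i := by
    simp_rw [mul_pow]
    rw [Finset.prod_mul_distrib, Finset.prod_pow_eq_pow_sum]
    congr 2
    rw [← Finsupp.degree_apply]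
    by_contra h
    exact (MvPolynomial.mem_support_iff.1 hm) (ha.coeff_eq_zero h)
  rw [h1]; ring

/-- The linear form with given coefficients. -/
noncomputable def linForm (K : Type*) [Field K] : (Fin 3 → K) →ₗ[K] MvPolynomial (Fin 3) K :=
  Fintype.linearCombination K X

section linForm

variable {K : Type*} [Field K]

theorem linForm_apply (φ : Fin 3 → K) : linForm K φ = ∑ i, φ i • X i :=
  Fintype.linearCombination_apply K X φ

theorem linForm_single (i : Fin 3) : linForm K (Pi.single i 1) = X i := by
  simp [linForm_apply, Pi.single_apply]

theorem isHomogeneous_linForm (φ : Fin 3 → K) : (linForm K φ).IsHomogeneous 1 := by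
  rw [linForm_apply]
  refine IsHomogeneous.sum _ _ _ fun i _ => ?_
  rw [smul_eq_C_mul]
  exact isHomogeneous_C_mul_X _ _

theorem exists_linForm_eq {a : MvPolynomial (Fin 3) K} (ha : a.IsHomogeneous 1) :
    ∃ φ, linForm K φ = a := by
  rw [← mem_homogeneousSubmodule, homogeneousSubmodule_one_eq_span_X,
    ← Fintype.range_linearCombination K] at ha
  exact ha

theorem eval_linForm (φ p : Fin 3 → K) : eval p (linForm K φ) = φ ⬝ᵥ p := by
  simp [linForm_apply, dotProduct, smul_eval]

theorem linForm_injective : Function.Injective (linForm K) := by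
  intro φ ψ h
  refine dotProduct_eq _ _ fun p => ?_
  rw [← eval_linForm, h, eval_linForm]

end linForm

namespace PlaneCurve

variable {K : Type*} [Field K] {d : ℕ} (C : PlaneCurve K d)

theorem toFrac_eq_zero_iff {a : MvPolynomial (Fin 3) K} : C.toFrac a = 0 ↔ C.poly ∣ a := by
  change algebraMap C.CoordRing C.Frac (Ideal.Quotient.mk _ a) = 0 ↔ _
  rw [map_eq_zero_iff _ (IsFractionRing.injective C.CoordRing C.Frac),
    Ideal.Quotient.eq_zero_iff_mem, Ideal.mem_span_singleton]

theorem toFrac_linForm_ne_zero (hd : 2 ≤ d) {φ : Fin 3 → K} (hφ : φ ≠ 0) :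
    C.toFrac (linForm K φ) ≠ 0 := by
  rw [Ne, toFrac_eq_zero_iff]
  rintro ⟨q, hq⟩
  have h0 : linForm K φ ≠ 0 := fun h => hφ (linForm_injective (by rw [h, map_zero]))
  have hq0 : q ≠ 0 := by rintro rfl; exact h0 (by rw [hq, mul_zero])
  have h1 := (isHomogeneous_linForm φ).totalDegree h0
  rw [hq, totalDegree_mul_of_isDomain C.irreducible.ne_zero hq0,
    C.homogeneous.totalDegree C.irreducible.ne_zero] at h1
  omega

/-- The quotient of linear forms `φ / ψ` as a rational function on the curve; the denominator
comes first. -/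
noncomputable def linQuot (ψ : Fin 3 → K) : (Fin 3 → K) →ₗ[K] C.functionField where
  toFun φ := ⟨C.toFrac (linForm K φ) / C.toFrac (linForm K ψ), by
    by_cases h : C.toFrac (linForm K ψ) = 0
    · rw [h, div_zero]; exact zero_mem _
    · exact ⟨1, _, _, isHomogeneous_linForm φ, isHomogeneous_linForm ψ, h, rfl⟩⟩
  map_add' φ φ' := Subtype.ext (by simp [add_div])
  map_smul' c φ := Subtype.ext (by simp [smul_div_assoc])

variable {C}

theorem linQuot_self (hd : 2 ≤ d) {ψ : Fin 3 → K} (hψ : ψ ≠ 0) : C.linQuot ψ ψ = 1 :=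
  Subtype.ext (div_self (C.toFrac_linForm_ne_zero hd hψ))

theorem linQuot_ne_zero (hd : 2 ≤ d) {ψ φ : Fin 3 → K} (hψ : ψ ≠ 0) (hφ : φ ≠ 0) :
    C.linQuot ψ φ ≠ 0 := fun h =>
  div_ne_zero (C.toFrac_linForm_ne_zero hd hφ) (C.toFrac_linForm_ne_zero hd hψ)
    (congrArg Subtype.val h)

theorem linQuot_div (hd : 2 ≤ d) {ψ χ : Fin 3 → K} (hψ : ψ ≠ 0) (φ : Fin 3 → K) :
    C.linQuot ψ φ / C.linQuot ψ χ = C.linQuot χ φ :=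
  Subtype.ext (div_div_div_cancel_right₀ (C.toFrac_linForm_ne_zero hd hψ) _ _)

theorem coe_aeval_linQuot {n : ℕ} {a : MvPolynomial (Fin 3) K} (ha : a.IsHomogeneous n)
    (ψ : Fin 3 → K) :
    ((aeval (fun i => C.linQuot ψ (Pi.single i 1)) a : C.functionField) : C.Frac) =
      C.toFrac a / C.toFrac (linForm K ψ) ^ n := by
  have h1 : ((aeval (fun i => C.linQuot ψ (Pi.single i 1)) a : C.functionField) : C.Frac) =
      aeval (fun i => (C.toFrac (linForm K ψ))⁻¹ * C.toFrac (X i)) a := by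
    have h2 : (C.functionField.val.comp (aeval fun i => C.linQuot ψ (Pi.single i 1))) =
        aeval (fun i => (C.toFrac (linForm K ψ))⁻¹ * C.toFrac (X i)) := by
      refine algHom_ext fun i => ?_
      rw [AlgHom.comp_apply, aeval_X, aeval_X]
      change C.toFrac (linForm K (Pi.single i 1)) / _ = _
      rw [linForm_single, div_eq_inv_mul]
    exact DFunLike.congr_fun h2 a
  have h3 : aeval (fun i => C.toFrac (X i)) a = C.toFrac a := by
    rw [← comp_aeval_apply, aeval_X_left_apply]
  rw [h1, aeval_mul_left_of_isHomogeneous ha, h3, inv_pow, div_eq_inv_mul]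

theorem aeval_linQuot_poly (ψ : Fin 3 → K) :
    aeval (fun i => C.linQuot ψ (Pi.single i 1)) C.poly = 0 := by
  refine Subtype.ext ?_
  rw [coe_aeval_linQuot C.homogeneous, C.toFrac_eq_zero_iff.2 dvd_rfl, zero_div]; rfl

/-- Dehomogenization by the linear form `ψ`. -/
theorem exists_eq_aeval_div (hd : 2 ≤ d) {ψ : Fin 3 → K} (hψ : ψ ≠ 0) (f : C.functionField) :
    ∃ a b : MvPolynomial (Fin 3) K,
      f = aeval (fun i => C.linQuot ψ (Pi.single i 1)) a /
        aeval (fun i => C.linQuot ψ (Pi.single i 1)) b := by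
  obtain ⟨f, n, a, b, ha, hb, h, rfl⟩ := f
  refine ⟨a, b, Subtype.ext ?_⟩
  change _ = ((aeval (fun i => C.linQuot ψ (Pi.single i 1)) a : C.functionField) : C.Frac) /
    ((aeval (fun i => C.linQuot ψ (Pi.single i 1)) b : C.functionField) : C.Frac)
  rw [coe_aeval_linQuot ha, coe_aeval_linQuot hb,
    div_div_div_cancel_right₀ (pow_ne_zero _ (C.toFrac_linForm_ne_zero hd hψ))]

theorem eq_top_of_linQuot_mem (hd : 2 ≤ d) {ψ : Fin 3 → K} (hψ : ψ ≠ 0)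
    {E : IntermediateField K C.functionField} (hE : ∀ φ, C.linQuot ψ φ ∈ E) : E = ⊤ := by
  rw [eq_top_iff]
  rintro f -
  obtain ⟨a, b, rfl⟩ := exists_eq_aeval_div hd hψ f
  have h : ∀ a : MvPolynomial (Fin 3) K,
      aeval (fun i => C.linQuot ψ (Pi.single i 1)) a ∈ E := by
    intro a
    rw [aeval_def]
    exact eval₂_mem (s := E.toSubring) (fun i _ => E.algebraMap_mem _) (fun i => hE _)
  exact div_mem (h a) (h b)

section plane

theorem exists_dependence {p : Fin 3 → K} (hp : p ≠ 0) (φ : Fin 3 → Fin 3 → K)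
    (h : ∀ i, φ i ⬝ᵥ p = 0) : ∃ w : Fin 3 → K, w ≠ 0 ∧ ∑ i, w i • φ i = 0 := by
  obtain ⟨w, hw, h1⟩ := Matrix.exists_vecMul_eq_zero_iff.2
    (Matrix.exists_mulVec_eq_zero_iff.1 ⟨p, hp, (funext h : Matrix.of φ *ᵥ p = 0)⟩)
  refine ⟨w, hw, ?_⟩
  rw [← h1, Matrix.vecMul_eq_sum]
  rfl

theorem exists_eq_combination {p q φ ψ χ : Fin 3 → K} (hφ : φ ≠ 0) (hφp : φ ⬝ᵥ p = 0)
    (hφq : φ ⬝ᵥ q = 0) (hψp : ψ ⬝ᵥ p = 0) (hψq : ψ ⬝ᵥ q ≠ 0) (hχ : χ ⬝ᵥ p = 0) (hp : p ≠ 0) :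
    ∃ a b : K, χ = a • φ + b • ψ := by
  obtain ⟨w, hw, h1⟩ := exists_dependence hp ![χ, φ, ψ] (by
    intro i; fin_cases i <;> simpa)
  simp only [Fin.sum_univ_three, Matrix.cons_val] at h1
  have h0 : w 0 ≠ 0 := by
    intro h0
    rw [h0, zero_smul, zero_add] at h1
    have h2 := congrArg (· ⬝ᵥ q) h1
    simp only [add_dotProduct, smul_dotProduct, hφq, zero_dotProduct, smul_eq_mul] at h2
    rw [mul_zero, zero_add, mul_eq_zero, or_iff_left hψq] at h2
    rw [h2, zero_smul, add_zero, smul_eq_zero] at h1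
    have h3 := h1.resolve_right hφ
    apply hw
    ext i
    fin_cases i <;> assumption
  refine ⟨-(w 0)⁻¹ * w 1, -(w 0)⁻¹ * w 2, ?_⟩
  have h4 : χ = (w 0)⁻¹ • (w 0 • χ) := by rw [smul_smul, inv_mul_cancel₀ h0, one_smul]
  rw [h4, eq_neg_of_add_eq_zero_left ((add_assoc _ _ _).symm.trans h1)]
  simp only [smul_neg, smul_add, smul_smul, neg_mul, neg_smul]
  abel

variable {P Q : Projectivization K (Fin 3 → K)}

theorem exists_line (h : P ≠ Q) :
    ∃ φ : Fin 3 → K, φ ≠ 0 ∧ φ ⬝ᵥ P.rep = 0 ∧ φ ⬝ᵥ Q.rep = 0 := by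
  refine ⟨P.rep ⨯₃ Q.rep, ?_, ?_, ?_⟩
  · rw [crossProduct_ne_zero_iff_linearIndependent]
    exact Projectivization.linearIndependent_pair_iff_ne.2 h
  · rw [dotProduct_comm]; exact dot_self_cross _ _
  · rw [dotProduct_comm]; exact dot_cross_self _ _

theorem exists_line_through (h : P ≠ Q) :
    ∃ ψ : Fin 3 → K, ψ ⬝ᵥ P.rep = 0 ∧ ψ ⬝ᵥ Q.rep ≠ 0 := by
  have h1 : Q.rep ⨯₃ P.rep ≠ 0 := by
    rw [crossProduct_ne_zero_iff_linearIndependent]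
    exact Projectivization.linearIndependent_pair_iff_ne.2 h.symm
  obtain ⟨i, hi⟩ := Function.ne_iff.1 h1
  -- The value of this form at `Q` is, by the triple product, the `i`-th coordinate of `Q × P`.
  refine ⟨P.rep ⨯₃ Pi.single i 1, ?_, ?_⟩
  · rw [dotProduct_comm]; exact dot_self_cross _ _
  · rw [dotProduct_comm, triple_product_permutation, triple_product_permutation,
      single_one_dotProduct]
    exact hi

end plane

theorem linQuot_mem_projectionField (hd : 2 ≤ d) {P : Projectivization K (Fin 3 → K)}
    {ψ φ : Fin 3 → K} (hψ : ψ ≠ 0) (hψP : ψ ⬝ᵥ P.rep = 0) (hφP : φ ⬝ᵥ P.rep = 0) :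
    C.linQuot ψ φ ∈ C.projectionField P :=
  IntermediateField.subset_adjoin _ _ ⟨_, _, isHomogeneous_linForm φ, isHomogeneous_linForm ψ,
    by rwa [eval_linForm], by rwa [eval_linForm], C.toFrac_linForm_ne_zero hd hψ, rfl⟩

/-- The lines through `P` form a pencil spanned by `φ` and `ψ`. Choosing `φ` through `q` makes the
generator a coordinate that vanishes in the direction of `q`, so its order there is a ramification
index. -/
theorem projectionField_eq_adjoin (hd : 2 ≤ d) {P : Projectivization K (Fin 3 → K)}
    {q φ ψ : Fin 3 → K} (hφ : φ ≠ 0) (hφp : φ ⬝ᵥ P.rep = 0)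
    (hφq : φ ⬝ᵥ q = 0) (hψp : ψ ⬝ᵥ P.rep = 0) (hψq : ψ ⬝ᵥ q ≠ 0) :
    C.projectionField P = IntermediateField.adjoin K {C.linQuot ψ φ} := by
  have hψ : ψ ≠ 0 := by rintro rfl; simp at hψq
  apply le_antisymm
  · refine IntermediateField.adjoin_le_iff.2 ?_
    rintro f ⟨a, b, ha, hb, haP, hbP, hb0, hf⟩
    obtain ⟨α, rfl⟩ := exists_linForm_eq ha
    obtain ⟨β, rfl⟩ := exists_linForm_eq hb
    rw [eval_linForm] at haP hbP
    have h1 : f = C.linQuot β α := Subtype.ext hf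
    have h2 : ∀ χ : Fin 3 → K, χ ⬝ᵥ P.rep = 0 →
        C.linQuot ψ χ ∈ IntermediateField.adjoin K {C.linQuot ψ φ} := by
      intro χ hχ
      obtain ⟨s, t, rfl⟩ := exists_eq_combination hφ hφp hφq hψp hψq hχ P.rep_nonzero
      rw [map_add, map_smul, map_smul, linQuot_self hd hψ]
      exact add_mem (IntermediateField.smul_mem _ (IntermediateField.mem_adjoin_simple_self K _))
        (IntermediateField.smul_mem _ (one_mem _))
    rw [h1, ← linQuot_div (χ := β) hd hψ α]
    exact div_mem (h2 _ haP) (h2 _ hbP)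
  · rw [IntermediateField.adjoin_simple_le_iff]
    exact linQuot_mem_projectionField hd hψ hψp hφp

theorem projectionField_sup (hd : 2 ≤ d) {P Q : Projectivization K (Fin 3 → K)} (h : P ≠ Q) :
    C.projectionField P ⊔ C.projectionField Q = ⊤ := by
  obtain ⟨φ, hφ, hφP, hφQ⟩ := exists_line h
  obtain ⟨ψ, hψP, hψQ⟩ := exists_line_through h
  refine eq_top_of_linQuot_mem hd hφ fun χ => ?_
  -- This constant splits `χ` into a form through `P` and a form through `Q`; the common denominator
  -- is the line `PQ`.
  set c := χ ⬝ᵥ Q.rep / ψ ⬝ᵥ Q.rep with hc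
  have h1 : χ = c • ψ + (χ - c • ψ) := by abel
  rw [h1, map_add, map_smul]
  refine add_mem (IntermediateField.smul_mem _ (le_sup_left (a := C.projectionField P)
    (linQuot_mem_projectionField hd hφ hφP hψP))) (le_sup_right (a := C.projectionField P)
    (linQuot_mem_projectionField hd hφ hφQ ?_))
  rw [sub_dotProduct, smul_dotProduct, hc, smul_eq_mul, div_mul_cancel₀ _ hψQ, sub_self]

theorem finiteDimensional_projectionField (hd : 2 ≤ d) {P : Projectivization K (Fin 3 → K)}
    [Algebra.IsAlgebraic (C.projectionField P) C.functionField] :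
    FiniteDimensional (C.projectionField P) C.functionField := by
  set M := C.projectionField P
  set S : Set C.functionField := Set.range fun i => C.linQuot (Pi.single 0 1) (Pi.single i 1)
  have h1 : FiniteDimensional M (IntermediateField.adjoin M S) :=
    IntermediateField.finiteDimensional_adjoin fun x _ => Algebra.IsIntegral.isIntegral x
  have h2 : (IntermediateField.adjoin M S).restrictScalars K = ⊤ := by
    refine eq_top_of_linQuot_mem hd (ψ := Pi.single 0 1) (by simp) fun φ => ?_
    rw [pi_eq_sum_univ' φ, map_sum]
    refine sum_mem fun i _ => ?_
    rw [map_smul]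
    exact IntermediateField.smul_mem ((IntermediateField.adjoin M S).restrictScalars K)
      (IntermediateField.subset_adjoin M S ⟨i, rfl⟩)
  have h3 : IntermediateField.adjoin M S = ⊤ := by
    rw [← IntermediateField.restrictScalars_eq_top_iff (K := K), h2]
  rw [h3] at h1
  exact LinearEquiv.finiteDimensional IntermediateField.topEquiv.toLinearEquiv

theorem hasTrdegLEOne_of_isAlgebraic (hd : 2 ≤ d) {P Q : Projectivization K (Fin 3 → K)}
    (h : P ≠ Q) [Algebra.IsAlgebraic (C.projectionField P) C.functionField] :
    HasTrdegLEOne K C.functionField := by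
  obtain ⟨φ, hφ, hφP, hφQ⟩ := exists_line h
  obtain ⟨ψ, hψP, hψQ⟩ := exists_line_through h
  refine .of_isAlgebraic (C.linQuot ψ φ) ?_
  rw [← IntermediateField.isAlgebraic_adjoin_iff_top,
    ← projectionField_eq_adjoin hd hφ hφP hφQ hψP hψQ]
  infer_instance

end PlaneCurve

end

/-! ### The image of the ramified place and the lines through it -/

open MvPolynomial Matrix

theorem MvPolynomial.exists_eq_eval_add_sum {K σ : Type*} [CommRing K] [Fintype σ] (q : σ → K)
    (a : MvPolynomial σ K) :
    ∃ h : σ → MvPolynomial σ K, a = C (eval q a) + ∑ l, h l * (X l - C (q l)) := by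
  have h1 : a - C (eval q a) ∈ Ideal.span (Set.range fun l => X l - C (q l)) := by
    induction a using MvPolynomial.induction_on with
    | C c => simp
    | add a b ha hb =>
      rw [map_add, map_add, add_sub_add_comm]
      exact add_mem ha hb
    | mul_X a i ih =>
      have h2 : a * X i - C (eval q (a * X i)) =
          a * (X i - C (q i)) + C (q i) * (a - C (eval q a)) := by
        rw [map_mul, eval_X, map_mul]; ring
      rw [h2]
      exact add_mem (Ideal.mul_mem_left _ _ (Ideal.subset_span ⟨i, rfl⟩))
        (Ideal.mul_mem_left _ _ ih)
  obtain ⟨h, hh⟩ := Ideal.mem_span_range_iff_exists_fun.1 h1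
  exact ⟨h, by rw [hh]; ring⟩

theorem MvPolynomial.eval_pderiv_of_eq {K σ : Type*} [CommRing K] [Fintype σ] {q : σ → K}
    {a : MvPolynomial σ K} {c : K} {h : σ → MvPolynomial σ K}
    (ha : a = C c + ∑ l, h l * (X l - C (q l))) (j : σ) :
    eval q (pderiv j a) = eval q (h j) := by
  classical
  rw [ha]
  simp [Derivation.leibniz, pderiv_X, Pi.single_apply, apply_ite (eval q)]

namespace Place

variable {K L : Type*} [Field K] [Field L] [Algebra K L] (v : Place K L)

/-- In a linear relation the term of least order cannot cancel. -/
theorem linearIndependent_of_ord_injective {ι : Type*} [Fintype ι] {f : ι → L}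
    (hf : ∀ i, f i ≠ 0) (hinj : Function.Injective fun i => v.ord (f i)) :
    LinearIndependent K f := by
  classical
  rw [Fintype.linearIndependent_iff]
  by_contra! ⟨w, hw, i, hi⟩
  obtain ⟨m, hm, hmin⟩ := Finset.exists_min_image (Finset.univ.filter fun i => w i ≠ 0)
    (fun i => v.ord (f i)) ⟨i, by simpa using hi⟩
  have hm0 : w m ≠ 0 := by simpa using hm
  rw [← Finset.add_sum_erase _ _ (Finset.mem_univ m)] at hw
  have h1 : w m • f m ∈ v.fil (v.ord (f m) + 1) := by
    rw [eq_neg_of_add_eq_zero_left hw, neg_mem_iff]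
    refine sum_mem fun j hj => ?_
    by_cases h0 : w j = 0
    · rw [h0, zero_smul]; exact zero_mem _
    refine Submodule.smul_mem _ _ ((v.mem_fil (hf j)).2 ?_)
    have h2 := hmin j (by simpa using h0)
    have h3 : v.ord (f j) ≠ v.ord (f m) := fun h => (Finset.ne_of_mem_erase hj) (hinj h)
    omega
  rw [Submodule.smul_mem_iff _ hm0, v.mem_fil (hf m)] at h1
  omega

end Place

namespace PlaneCurve

variable {K : Type*} [Field K] {d : ℕ} {C : PlaneCurve K d} {v : Place K C.functionField}
  {Q : Projectivization K (Fin 3 → K)}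

theorem ne_zero_of_dotProduct_ne_zero {ψ q : Fin 3 → K} (h : ψ ⬝ᵥ q ≠ 0) : ψ ≠ 0 := by
  rintro rfl; simp at h

theorem MapsTo.linQuot_mem (hQ : C.MapsTo v Q) {ψ : Fin 3 → K} (hψ : ψ ⬝ᵥ Q.rep ≠ 0)
    (φ : Fin 3 → K) : C.linQuot ψ φ ∈ v.fil 0 ∧
      (C.linQuot ψ φ ∈ v.fil 1 ↔ φ ⬝ᵥ Q.rep = 0) := by
  obtain ⟨f, hf, hf'⟩ := hQ 1 (linForm K φ) (linForm K ψ) (isHomogeneous_linForm φ)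
    (isHomogeneous_linForm ψ) (by rwa [eval_linForm])
  have h : (f : C.functionField) = C.linQuot ψ φ := Subtype.ext hf
  rw [v.mem_maximalIdeal, h, eval_linForm] at hf'
  exact ⟨h ▸ v.mem_fil_zero.2 f.2, hf'⟩

theorem MapsTo.ord_linQuot_eq_zero (hd : 2 ≤ d) (hQ : C.MapsTo v Q) {ψ φ : Fin 3 → K}
    (hψ : ψ ⬝ᵥ Q.rep ≠ 0) (hφ : φ ⬝ᵥ Q.rep ≠ 0) : v.ord (C.linQuot ψ φ) = 0 := by
  obtain ⟨h1, h2⟩ := hQ.linQuot_mem hψ φ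
  rw [v.ord_eq_iff (linQuot_ne_zero hd (ne_zero_of_dotProduct_ne_zero hψ)
    (ne_zero_of_dotProduct_ne_zero hφ))]
  exact ⟨h1, fun h => hφ (h2.1 h)⟩

/-- Every linear form through `Q` vanishes at `v` to order at least two. -/
def TangentVanishing (v : Place K C.functionField) (Q : Projectivization K (Fin 3 → K)) : Prop :=
  ∀ ψ φ : Fin 3 → K, ψ ⬝ᵥ Q.rep ≠ 0 → φ ⬝ᵥ Q.rep = 0 → C.linQuot ψ φ ∈ v.fil 2

theorem DifferentialIsZeroAt.exists_tangentVanishing (h : C.DifferentialIsZeroAt v) :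
    ∃ Q, C.MapsTo v Q ∧ TangentVanishing v Q := by
  obtain ⟨Q, hQ, h⟩ := h
  refine ⟨Q, hQ, fun ψ φ hψ hφ => ?_⟩
  obtain ⟨f, hf, hf'⟩ := h 1 (linForm K φ) (linForm K ψ) (isHomogeneous_linForm φ)
    (isHomogeneous_linForm ψ) (by rwa [eval_linForm]) (by rwa [eval_linForm])
  have h : (f : C.functionField) = C.linQuot ψ φ := Subtype.ext hf
  rw [v.mem_maximalIdeal_pow, h] at hf'
  exact hf'

theorem exists_rep_ne_zero (Q : Projectivization K (Fin 3 → K)) : ∃ k, Q.rep k ≠ 0 :=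
  Function.ne_iff.1 Q.rep_nonzero

section affine

/-- Normalized coordinates of a point, with `k`-th coordinate `1`. -/
noncomputable def affinePoint (Q : Projectivization K (Fin 3 → K)) (k : Fin 3) : Fin 3 → K :=
  fun i => (Q.rep k)⁻¹ * Q.rep i

variable {k : Fin 3}

theorem eval_affinePoint {n : ℕ} {a : MvPolynomial (Fin 3) K} (ha : a.IsHomogeneous n) :
    eval (affinePoint Q k) a = (Q.rep k)⁻¹ ^ n * eval Q.rep a := by
  rw [← coe_aeval_eq_eval, ← coe_aeval_eq_eval]
  exact aeval_mul_left_of_isHomogeneous ha _ _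

/-- The difference of an affine coordinate function and its value at `Q`. -/
noncomputable def localCoord (C : PlaneCurve K d) (Q : Projectivization K (Fin 3 → K))
    (k i : Fin 3) : C.functionField :=
  C.linQuot (Pi.single k 1) (Pi.single i 1 - affinePoint Q k i • Pi.single k 1)

theorem aeval_sub_eval (hd : 2 ≤ d) {a : MvPolynomial (Fin 3) K} {c : K}
    {h : Fin 3 → MvPolynomial (Fin 3) K}
    (ha : a = MvPolynomial.C c + ∑ l, h l * (X l - MvPolynomial.C (affinePoint Q k l))) :
    aeval (fun i => C.linQuot (Pi.single k 1) (Pi.single i 1)) a =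
      algebraMap K _ c + ∑ l, aeval (fun i => C.linQuot (Pi.single k 1) (Pi.single i 1)) (h l) *
        localCoord C Q k l := by
  have hk : (Pi.single k 1 : Fin 3 → K) ≠ 0 := by simp
  conv_lhs => rw [ha]
  rw [map_add, map_sum, aeval_C]
  congr 1
  refine Finset.sum_congr rfl fun l _ => ?_
  rw [map_mul, map_sub, aeval_X, aeval_C, localCoord, map_sub, map_smul, linQuot_self hd hk,
    Algebra.algebraMap_eq_smul_one]

theorem dotProduct_localCoord (hk : Q.rep k ≠ 0) (i : Fin 3) :
    (Pi.single i 1 - affinePoint Q k i • Pi.single k 1 : Fin 3 → K) ⬝ᵥ Q.rep = 0 := by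
  rw [sub_dotProduct, smul_dotProduct, single_one_dotProduct, single_one_dotProduct, affinePoint,
    smul_eq_mul]
  field_simp
  ring

theorem localCoord_self (hk : Q.rep k ≠ 0) : localCoord C Q k k = 0 := by
  rw [localCoord, affinePoint, inv_mul_cancel₀ hk, one_smul, sub_self, map_zero]

theorem localCoord_ne_zero (hd : 2 ≤ d) {i : Fin 3} (hik : i ≠ k) : localCoord C Q k i ≠ 0 := by
  refine linQuot_ne_zero hd (by simp) fun h => ?_
  have := congrFun h i
  simp [hik] at this

theorem MapsTo.aeval_mem_ring (hQ : C.MapsTo v Q) (hk : Q.rep k ≠ 0)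
    (a : MvPolynomial (Fin 3) K) :
    aeval (fun i => C.linQuot (Pi.single k 1) (Pi.single i 1)) a ∈ v.ring := by
  rw [aeval_def]
  exact eval₂_mem (s := v.ring.toSubring) (fun i _ => v.algebraMap_mem _) (fun i =>
    v.mem_fil_zero.1 (hQ.linQuot_mem (by rwa [single_one_dotProduct]) _).1)

theorem MapsTo.aeval_sub_mem (hd : 2 ≤ d) (hQ : C.MapsTo v Q) (hk : Q.rep k ≠ 0)
    (a : MvPolynomial (Fin 3) K) :
    aeval (fun i => C.linQuot (Pi.single k 1) (Pi.single i 1)) a -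
      algebraMap K _ (eval (affinePoint Q k) a) ∈ v.fil 1 := by
  obtain ⟨h, ha⟩ := exists_eq_eval_add_sum (affinePoint Q k) a
  rw [aeval_sub_eval hd ha, add_sub_cancel_left]
  refine sum_mem fun l _ => ?_
  refine v.mul_mem_fil_of_eq (v.mem_fil_zero.2 (hQ.aeval_mem_ring hk _))
    ((hQ.linQuot_mem (by rwa [single_one_dotProduct]) _).2.2 (dotProduct_localCoord hk l))
    (zero_add _).ge

/-- The value at `Q` of the dehomogenized equation is a constant that vanishes at `v`. -/
theorem MapsTo.hasPoint (hd : 2 ≤ d) (hQ : C.MapsTo v Q) : C.HasPoint Q := by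
  obtain ⟨k, hk⟩ := exists_rep_ne_zero Q
  have h1 := hQ.aeval_sub_mem hd hk C.poly
  rw [aeval_linQuot_poly, zero_sub, neg_mem_iff] at h1
  have h2 := v.eq_zero_of_algebraMap_mem_fil one_pos h1
  rw [eval_affinePoint C.homogeneous, mul_eq_zero] at h2
  exact h2.resolve_left (pow_ne_zero _ (inv_ne_zero hk))

/-- The image of a place at which the differential vanishes is not a smooth point. -/
theorem MapsTo.not_isSmoothPoint (hd : 2 ≤ d) (hQ : C.MapsTo v Q) (ht : TangentVanishing v Q) :
    ¬ C.IsSmoothPoint Q := by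
  rintro ⟨hP, hs⟩
  obtain ⟨k, hk⟩ := exists_rep_ne_zero Q
  have hk' : (Pi.single k 1 : Fin 3 → K) ⬝ᵥ Q.rep ≠ 0 := by rwa [single_one_dotProduct]
  -- By Euler's formula, the `k`-th partial derivative cannot be the only one that is nonzero at
  -- `Q`.
  obtain ⟨j, hjk, hj⟩ : ∃ j, j ≠ k ∧ eval Q.rep (pderiv j C.poly) ≠ 0 := by
    by_contra! hall
    have h1 := congrArg (eval Q.rep) C.homogeneous.sum_X_mul_pderiv
    rw [map_sum, Finset.sum_eq_single k] at h1
    · have hP' : eval Q.rep C.poly = 0 := hP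
      rw [map_mul, eval_X, map_nsmul, hP', smul_zero, mul_eq_zero] at h1
      obtain ⟨i, hi⟩ := hs
      by_cases hik : i = k
      · exact hi (hik ▸ h1.resolve_left hk)
      · exact hi (hall i hik)
    · intro i _ hi
      rw [map_mul, hall i hi, mul_zero]
    · simp
  obtain ⟨i, hik, hij, huniv⟩ : ∃ i, i ≠ k ∧ i ≠ j ∧ ∀ f : Fin 3 → C.functionField,
      ∑ l, f l = f i + f j + f k := by
    fin_cases j <;> fin_cases k <;> first | exact absurd rfl hjk | skip
    · exact ⟨2, by decide, by decide, fun f => by rw [Fin.sum_univ_three]; simp; ring⟩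
    · exact ⟨1, by decide, by decide, fun f => by rw [Fin.sum_univ_three]; simp; ring⟩
    · exact ⟨2, by decide, by decide, fun f => by rw [Fin.sum_univ_three]; simp; ring⟩
    · exact ⟨0, by decide, by decide, fun f => by rw [Fin.sum_univ_three]; simp⟩
    · exact ⟨1, by decide, by decide, fun f => by rw [Fin.sum_univ_three]; simp; ring⟩
    · exact ⟨0, by decide, by decide, fun f => by rw [Fin.sum_univ_three]; simp; ring⟩
  set x : Fin 3 → C.functionField := fun i => C.linQuot (Pi.single k 1) (Pi.single i 1) with hx
  set q := affinePoint Q k with hq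
  set y := localCoord C Q k with hy
  have hunit : ∀ a, eval q a ≠ 0 → aeval x a ≠ 0 ∧ v.ord (aeval x a) = 0 := fun a ha =>
    v.ord_eq_zero_of_sub_algebraMap_mem ha (hQ.aeval_sub_mem hd hk a)
  obtain ⟨h, hh⟩ := exists_eq_eval_add_sum q C.poly
  have hrel := aeval_sub_eval (C := C) hd hh
  have hP' : eval q C.poly = 0 := by
    have : eval Q.rep C.poly = 0 := hP
    rw [hq, eval_affinePoint C.homogeneous, this, mul_zero]
  rw [aeval_linQuot_poly, hP', map_zero, zero_add, huniv, localCoord_self hk, mul_zero,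
    add_zero] at hrel
  have hhj : eval q (h j) ≠ 0 := by
    rw [← eval_pderiv_of_eq hh j, hq, eval_affinePoint C.homogeneous.pderiv]
    exact mul_ne_zero (pow_ne_zero _ (inv_ne_zero hk)) hj
  obtain ⟨hA0, hA⟩ := hunit _ hhj
  have hyi : y i ≠ 0 := localCoord_ne_zero hd hik
  have he : 2 ≤ v.ord (y i) :=
    (v.mem_fil hyi).1 (ht _ _ hk' (dotProduct_localCoord hk i))
  -- By `hrel` and the unit `h j`, the coordinate `y i` generates the maximal ideal at `Q`. So a
  -- polynomial function vanishing at `Q` is, up to a unit, `y i` times another one of smaller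
  -- order, and all orders are multiples of that of `y i`.
  have key : ∀ (n : ℕ) (a : MvPolynomial (Fin 3) K), aeval x a ≠ 0 → v.ord (aeval x a) ≤ n →
      v.ord (y i) ∣ v.ord (aeval x a) := by
    intro n
    induction n using Nat.strong_induction_on with
    | _ n ih =>
      intro a ha hn
      by_cases hqa : eval q a = 0
      · obtain ⟨g, hg⟩ := exists_eq_eval_add_sum q a
        have h1 := aeval_sub_eval (C := C) hd hg
        rw [hqa, map_zero, zero_add, huniv, localCoord_self hk, mul_zero, add_zero] at h1
        change aeval x a = _ at h1
        have h2 : aeval x (h j) * aeval x a = y i * aeval x (h j * g i - g j * h i) := by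
          rw [map_sub, map_mul, map_mul, h1]
          linear_combination (-aeval x (g j)) * hrel
        have h3 : aeval x (h j * g i - g j * h i) ≠ 0 := by
          intro h0
          rw [h0, mul_zero] at h2
          exact mul_ne_zero hA0 ha h2
        have h4 := congrArg v.ord h2
        rw [v.ord_mul hA0 ha, v.ord_mul hyi h3, hA, zero_add] at h4
        have h5 : 0 ≤ v.ord (aeval x (h j * g i - g j * h i)) :=
          (v.mem_ring_iff h3).1 (hQ.aeval_mem_ring hk _)
        rw [h4]
        refine dvd_add dvd_rfl (ih (n - 1) (by omega) _ h3 (by omega))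
      · rw [(hunit a hqa).2]; exact dvd_zero _
  -- A uniformizer at `v` is a quotient of such functions, so the order of `y i`, at least 2, would
  -- divide 1.
  obtain ⟨a, b, hab⟩ := exists_eq_aeval_div hd (C := C) (ψ := Pi.single k 1) (by simp) v.unif
  change v.unif = aeval x a / aeval x b at hab
  have ha : aeval x a ≠ 0 := by
    intro h0; rw [h0, zero_div] at hab; exact v.unif_ne_zero hab
  have hb : aeval x b ≠ 0 := by
    intro h0; rw [h0, div_zero] at hab; exact v.unif_ne_zero hab
  have h1 := v.ord_unif
  rw [hab, v.ord_div ha hb] at h1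
  have h2 := dvd_sub (key _ a ha (Int.self_le_toNat _)) (key _ b hb (Int.self_le_toNat _))
  rw [h1] at h2
  have := Int.le_of_dvd one_pos h2
  omega

end affine

/-- Two distinct Galois points, both different from the image of a place at which the
differential vanishes, are on lines with different orders of contact. -/
theorem ord_linQuot_ne [IsAlgClosed K] [CharZero K] (hd : 2 ≤ d) (hg : 1 ≤ C.genus)
    (hQ : C.MapsTo v Q) (ht : TangentVanishing v Q) {ψ : Fin 3 → K} (hψ : ψ ⬝ᵥ Q.rep ≠ 0)
    {P₁ P₂ : Projectivization K (Fin 3 → K)} (h₁ : P₁ ≠ Q) (h₂ : P₂ ≠ Q) (h₁₂ : P₁ ≠ P₂)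
    (hG₁ : C.ProjectionIsGalois P₁) (hG₂ : C.ProjectionIsGalois P₂) {φ₁ φ₂ : Fin 3 → K}
    (hφ₁ : φ₁ ≠ 0) (hφ₂ : φ₂ ≠ 0) (hφP₁ : φ₁ ⬝ᵥ P₁.rep = 0) (hφP₂ : φ₂ ⬝ᵥ P₂.rep = 0)
    (hφQ₁ : φ₁ ⬝ᵥ Q.rep = 0) (hφQ₂ : φ₂ ⬝ᵥ Q.rep = 0) :
    v.ord (C.linQuot ψ φ₁) ≠ v.ord (C.linQuot ψ φ₂) := by
  have hψ0 := ne_zero_of_dotProduct_ne_zero hψ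
  have key : ∀ {P : Projectivization K (Fin 3 → K)} {φ : Fin 3 → K}, P ≠ Q → φ ≠ 0 →
      φ ⬝ᵥ P.rep = 0 → φ ⬝ᵥ Q.rep = 0 → ∃ u, u ≠ 0 ∧
      C.projectionField P = IntermediateField.adjoin K {u} ∧
      v.ord u = v.ord (C.linQuot ψ φ) := by
    intro P φ hP hφ hφP hφQ
    obtain ⟨χ, hχP, hχQ⟩ := exists_line_through hP
    have hχ0 := ne_zero_of_dotProduct_ne_zero hχQ
    refine ⟨C.linQuot χ φ, linQuot_ne_zero hd hχ0 hφ,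
      projectionField_eq_adjoin hd hφ hφP hφQ hχP hχQ, ?_⟩
    -- Changing the denominator does not change the order, as neither form vanishes at `Q`.
    rw [← linQuot_div hd hψ0, v.ord_div (linQuot_ne_zero hd hψ0 hφ)
      (linQuot_ne_zero hd hψ0 hχ0), hQ.ord_linQuot_eq_zero hd hψ hχQ, sub_zero]
  obtain ⟨u₁, hu₁, hM₁, ho₁⟩ := key h₁ hφ₁ hφP₁ hφQ₁
  obtain ⟨u₂, hu₂, hM₂, ho₂⟩ := key h₂ hφ₂ hφP₂ hφQ₂
  have : IsGalois (C.projectionField P₁) C.functionField := hG₁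
  have : IsGalois (C.projectionField P₂) C.functionField := hG₂
  have := finiteDimensional_projectionField hd (C := C) (P := P₁)
  have := finiteDimensional_projectionField hd (C := C) (P := P₂)
  rw [← ho₁, ← ho₂]
  refine Place.ord_ne_ord_of_isGalois (hasTrdegLEOne_of_isAlgebraic (C := C) hd h₁) hg v hu₁ hu₂ ?_ hM₁ hM₂
    (projectionField_sup hd h₁₂)
  rw [ho₁, ← v.mem_fil (linQuot_ne_zero hd hψ0 hφ₁)]
  exact ht _ _ hψ hφQ₁

end PlaneCurve

/-! ### At most two Galois points -/

theorem theorem1 {K : Type*} [Field K] [IsAlgClosed K] [CharZero K] {d : ℕ} (hd : 4 ≤ d)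
    (C : PlaneCurve K d) (hg : 1 ≤ C.genus)
    (hr : ∃ v : Place K C.functionField, C.DifferentialIsZeroAt v) :
    C.delta + C.delta' ≤ 2 := by
  obtain ⟨v, hv⟩ := hr
  obtain ⟨Q, hQ, ht⟩ := hv.exists_tangentVanishing
  have hd2 : 2 ≤ d := by omega
  rw [PlaneCurve.delta, PlaneCurve.delta', ← Set.encard_union_eq
    (Set.disjoint_left.2 fun P h1 h2 => h2.1 h1.1.1)]
  have hT : ∀ P ∈ C.innerGaloisPoints ∪ C.outerGaloisPoints,
      P ≠ Q ∧ C.ProjectionIsGalois P := by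
    rintro P (⟨hP, hG⟩ | ⟨hP, hG⟩)
    · exact ⟨fun h => hQ.not_isSmoothPoint hd2 ht (h ▸ hP), hG⟩
    · exact ⟨fun h => hP (h ▸ hQ.hasPoint hd2), hG⟩
  by_contra! hlt
  obtain ⟨S, hS, hS3⟩ := Set.exists_subset_encard_eq (Order.add_one_le_of_lt hlt)
  obtain ⟨P₀, P₁, P₂, h01, h02, h12, rfl⟩ := Set.encard_eq_three.1 (hS3.trans (by norm_num))
  have hP : ∀ i, (![P₀, P₁, P₂] i) ≠ Q ∧ C.ProjectionIsGalois (![P₀, P₁, P₂] i) := by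
    intro i
    apply hT
    apply hS
    fin_cases i <;> simp
  have hinj : Function.Injective ![P₀, P₁, P₂] := by
    intro i j hij
    fin_cases i <;> fin_cases j <;> simp_all
  choose φ hφ hφP hφQ using fun i => PlaneCurve.exists_line (hP i).1
  obtain ⟨k, hk⟩ := PlaneCurve.exists_rep_ne_zero Q
  have hk' : (Pi.single k 1 : Fin 3 → K) ⬝ᵥ Q.rep ≠ 0 := by rwa [single_one_dotProduct]
  have hli := v.linearIndependent_of_ord_injective
    (f := fun i => C.linQuot (Pi.single k 1) (φ i))
    (fun i => PlaneCurve.linQuot_ne_zero hd2 (by simp) (hφ i)) (by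
      intro i j hij
      by_contra hne
      exact PlaneCurve.ord_linQuot_ne hd2 hg hQ ht hk' (hP i).1 (hP j).1 (hinj.ne hne)
        (hP i).2 (hP j).2 (hφ i) (hφ j) (hφP i) (hφP j) (hφQ i) (hφQ j) hij)
  -- The three forms all vanish at `Q`, so they are dependent, against the independence of their
  -- quotients.
  obtain ⟨w, hw, h0⟩ := PlaneCurve.exists_dependence Q.rep_nonzero φ hφQ
  refine hw (funext (Fintype.linearIndependent_iff.1 hli w ?_))
  have := congrArg (C.linQuot (Pi.single k 1)) h0
  simpa [map_sum] using this
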